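/- Setting. Let $\mathscr M$ be a von Neumann algebra with a faithful normal tracial state $\varphi$ (for example a $\mathrm{II}_1$-factor with its trace), and let $L^2(\mathscr M,\varphi)$ be the completion of $\mathscr M$ for $\langle x,y\rangle=\varphi(x^*y)$. The free cumulants $\kappa_n$ of $\varphi$ are the multilinear functionals determined by $\varphi(x_1\cdots x_n)=\sum_{\pi\in NC(n)}\prod_{V\in\pi}\kappa_{|V|}[x_i:i\in V]$, $n\ge1$, where $NC(n)$ is the set of non-crossing partitions of $\{1,\dots,n\}$. An operator $a\in\mathscr M$ is $\mathscr R$-diagonal if the only non-zero free cumulants of $\{a,a^*\}$ are of the form $\kappa_{2n}[a,a^*,\dots,a,a^*]$ or $\kappa_{2n}[a^*,a,\dots,a^*,a]$. A family $(a_i)$ is $*$-free if all mixed free cumulants of the families $\{a_i,a_i^*\}$ vanish. For a family $(a_i)$ in $\mathscr M$, $L^2_{hol}((a_i))\subset L^2(\mathscr M,\varphi)$ is the closed subspace generated by the unital (non-$*$) algebra generated by the $a_i$. For even $p\ge2$ and $x\in\mathscr M$, $\|x\|_p=\varphi((x^*x)^{p/2})^{1/p}$; $L^p(W^*((a_i)),\varphi)$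 is the completion of the generated von Neumann algebra $W^*((a_i))$ for $\|\cdot\|_p$, viewed inside $L^2(\mathscr M,\varphi)$, and $\|\xi\|_p=\infty$ for $\xi\in L^2(\mathscr M,\varphi)$ outside $L^p(W^*((a_i)),\varphi)$. Norms of operators into $L^p$ are taken in $[0,\infty]$. Theorem. For each even integer $p\ge2$ there is a constant $\alpha_p>0$, depending only on $p$, such that the following holds. Let $a_1,a_2,\dots$ be a finite or infinite $*$-free family of $\mathscr R$-diagonal operators in some $(\mathscr M,\varphi)$ as above, with a distinguished member $a_1\neq0$ that has non-negative free cumulants: $\kappa_{2n}[a_1,a_1^*,\dots,a_1,a_1^*]\ge0$ and $\kappa_{2n}[a_1^*,a_1,\dots,a_1^*,a_1]\ge0$ for each $n$. Then for every $0<t<1$ there is a unique bounded operator $D_t$ on $L^2_{hol}(a_1,a_2,\dots)$ with $D_t(a_{i_1}\cdots a_{i_n})=e^{-nt}a_{i_1}\cdots a_{i_n}$ for all words (including the empty word), and \[ \|D_t\colon L^2_{hol}(a_1,a_2,\dots)\to L^p(W^*(a_1,a_2,\dots),\varphi)\|\ \ge\ \alpha_p\,t^{-1+\frac2p}. \] Moreover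 this bound is achieved on the subspace $L^2_{hol}(a_1)$: \[ \|D_t|_{L^2_{hol}(a_1)}\colon L^2_{hol}(a_1)\to L^p(W^*(a_1,a_2,\dots),\varphi)\|\ \ge\ \alpha_p\,t^{-1+\frac2p}, \] and it is witnessed by the resolvent of the normalized generator $a=a_1/\|a_1\|_2$: the series $\psi_t=\sum_{n\ge0}e^{-nt}a^n$ converges in $L^2$ to a non-zero element of $L^2_{hol}(a_1)$, and $\|D_t\psi_t\|_p\ge\alpha_p\,t^{-1+\frac2p}\,\|\psi_t\|_2$. -/

import Mathlib

open scoped ComplexOrder ENNReal Topology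
open Filter

universe u v

namespace FreeProb

/-! ### Traces and free cumulants -/

/-- A faithful tracial state on a unital complex `*`-algebra. -/
structure FaithfulTrace (A : Type*) [Ring A] [StarRing A] [Algebra ℂ A] where
  toLinear : A →ₗ[ℂ] ℂ
  map_one' : toLinear 1 = 1
  nonneg' : ∀ x : A, 0 ≤ toLinear (star x * x)
  faithful' : ∀ x : A, toLinear (star x * x) = 0 → x = 0
  tracial' : ∀ x y : A, toLinear (x * y) = toLinear (y * x)

instance {A : Type*} [Ring A] [StarRing A] [Algebra ℂ A] :
    CoeFun (FaithfulTrace A) (fun _ => A → ℂ) where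
  coe φ := fun x => φ.toLinear x

/-- A partition of `{0, …, n-1}` is non-crossing if there are no `i < j < k < l` with `i, k` in one
block and `j, l` in a different block. -/
def IsNonCrossing {n : ℕ} (π : Finpartition (Finset.univ : Finset (Fin n))) : Prop :=
  ∀ B ∈ π.parts, ∀ C ∈ π.parts, ∀ i ∈ B, ∀ j ∈ C, ∀ k ∈ B, ∀ l ∈ C,
    i < j → j < k → k < l → B = C

open Classical in
/-- The non-crossing partitions of `{0, …, n-1}` other than the one-block partition. -/
noncomputable def properNC (n : ℕ) : Finset (Finpartition (Finset.univ : Finset (Fin n))) :=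
  Finset.univ.filter fun π => IsNonCrossing π ∧ Finset.univ ∉ π.parts

theorem card_lt_of_mem_properNC {n : ℕ} {π : Finpartition (Finset.univ : Finset (Fin n))}
    (hπ : π ∈ properNC n) {V : Finset (Fin n)} (hV : V ∈ π.parts) : V.card < n := by
  classical
  have h : Finset.univ ∉ π.parts := by
    simp only [properNC, Finset.mem_filter] at hπ
    exact hπ.2.2
  have hne : V ≠ Finset.univ := fun e => h (e ▸ hV)
  have := Finset.card_lt_card (Finset.ssubset_univ_iff.mpr hne)
  simpa using this

/-- The free cumulants `κ_n[x_1, …, x_n]` of a functional `φ`, i.e. the solution of the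
moment-cumulant formula `φ (x_1 ⋯ x_n) = ∑_{π ∈ NC(n)} ∏_{V ∈ π} κ_{|V|}[x_i : i ∈ V]`
(arguments in increasing order), solved recursively for the term of the one-block partition. -/
noncomputable def freeCumulant {A : Type*} [Monoid A] (φ : A → ℂ) (n : ℕ) (x : Fin n → A) : ℂ :=
  φ (List.ofFn x).prod -
    ∑ π ∈ (properNC n).attach, ∏ V ∈ π.1.parts.attach,
      freeCumulant φ V.1.card fun i => x (V.1.orderEmbOfFin rfl i)
termination_by n
decreasing_by exact card_lt_of_mem_properNC π.2 V.2

/-- `a` or its adjoint: `starPow a false = a`, `starPow a true = a*`. -/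
def starPow {A : Type*} [Star A] (a : A) (ε : Bool) : A := if ε then star a else a

section Algebraic

variable {A : Type*} [Ring A] [StarRing A] [Algebra ℂ A]

/-- `(a_i)` are `*`-free: all mixed free cumulants of the families `{a_i, a_i*}` vanish. -/
def StarFree {ι : Type*} (φ : FaithfulTrace A) (a : ι → A) : Prop :=
  ∀ (n : ℕ) (i : Fin n → ι) (ε : Fin n → Bool), (∃ k l, i k ≠ i l) →
    freeCumulant φ n (fun k => starPow (a (i k)) (ε k)) = 0

/-- `a` is `R`-diagonal: a non-zero free cumulant of `{a, a*}` has even length, and its arguments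
alternate between `a` and `a*`. -/
def IsRDiagonal (φ : FaithfulTrace A) (a : A) : Prop :=
  ∀ (n : ℕ) (ε : Fin n → Bool), freeCumulant φ n (fun k => starPow a (ε k)) ≠ 0 →
    Even n ∧ ∀ k l : Fin n, (l : ℕ) = k + 1 → ε l ≠ ε k

/-- `κ_{2n}[a, a*, …, a, a*] ≥ 0` and `κ_{2n}[a*, a, …, a*, a] ≥ 0` for all `n`
(real and non-negative). -/
def HasNonnegCumulants (φ : FaithfulTrace A) (a : A) : Prop :=
  ∀ n : ℕ,
    0 ≤ freeCumulant φ (2 * n) (fun k => if Even (k : ℕ) then a else star a) ∧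
    0 ≤ freeCumulant φ (2 * n) (fun k => if Even (k : ℕ) then star a else a)

/-! ### The space `L²(φ)` -/

variable [StarModule ℂ A]

theorem FaithfulTrace.map_star (φ : FaithfulTrace A) (x : A) :
    φ (star x) = (starRingEnd ℂ) (φ x) := by
  have h0 := (Complex.nonneg_iff.mp (φ.nonneg' x)).2
  have h1 := (Complex.nonneg_iff.mp (φ.nonneg' (1 + x))).2
  have h2 := (Complex.nonneg_iff.mp (φ.nonneg' (1 + Complex.I • x))).2
  simp [add_mul, mul_add, φ.map_one', smul_smul] at h0 h1 h2
  apply Complex.ext <;> simp <;> linarith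

set_option linter.unusedVariables false in
/-- Type synonym of `A`, carrying the inner product `⟨x, y⟩ = φ (x* y)`. -/
def PreL2 (φ : FaithfulTrace A) : Type _ := A

instance (φ : FaithfulTrace A) : AddCommGroup (PreL2 φ) := inferInstanceAs (AddCommGroup A)
instance (φ : FaithfulTrace A) : Module ℂ (PreL2 φ) := inferInstanceAs (Module ℂ A)

/-- The identity map `A → PreL2 φ`. -/
def toPreL2 (φ : FaithfulTrace A) : A ≃ₗ[ℂ] PreL2 φ := LinearEquiv.refl ℂ A

noncomputable abbrev preL2Core (φ : FaithfulTrace A) : InnerProductSpace.Core ℂ (PreL2 φ) where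
  inner x y := φ (star ((toPreL2 φ).symm x) * (toPreL2 φ).symm y)
  conj_inner_symm x y := by rw [← φ.map_star]; simp
  re_inner_nonneg x := (Complex.nonneg_iff.mp (φ.nonneg' _)).1
  add_left x y z := by simp [add_mul]
  smul_left x y r := by simp
  definite x hx := by simpa using φ.faithful' _ hx

noncomputable instance (φ : FaithfulTrace A) : NormedAddCommGroup (PreL2 φ) :=
  (preL2Core φ).toNormedAddCommGroup

noncomputable instance (φ : FaithfulTrace A) : InnerProductSpace ℂ (PreL2 φ) :=
  InnerProductSpace.ofCore (preL2Core φ).toCore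

/-- The Hilbert space `L²(A, φ)`: the completion of `A` for `⟨x, y⟩ = φ (x* y)`. -/
abbrev L2 (φ : FaithfulTrace A) : Type _ := UniformSpace.Completion (PreL2 φ)

/-- The canonical embedding `A → L²(A, φ)`. -/
noncomputable def toL2 (φ : FaithfulTrace A) : A →ₗ[ℂ] L2 φ :=
  (UniformSpace.Completion.toComplL (𝕜 := ℂ) (E := PreL2 φ)).toLinearMap ∘ₗ
    (toPreL2 φ).toLinearMap

/-- `L²_hol(S)`: the closed subspace of `L²(A, φ)` generated by the unital (non-`*`) algebra
generated by `S`. -/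
noncomputable def L2hol (φ : FaithfulTrace A) (S : Set A) : Submodule ℂ (L2 φ) :=
  ((Subalgebra.toSubmodule (Algebra.adjoin ℂ S)).map (toL2 φ)).topologicalClosure

/-- The word `a_{i_1} ⋯ a_{i_n}` as an element of `L²_hol`. -/
noncomputable def word {ι : Type*} (φ : FaithfulTrace A) (a : ι → A) (w : List ι) :
    L2hol φ (Set.range a) :=
  ⟨toL2 φ (w.map a).prod, Submodule.le_topologicalClosure _ (Submodule.mem_map_of_mem
    (Subalgebra.list_prod_mem (Algebra.adjoin ℂ (Set.range a)) fun x hx => by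
      obtain ⟨i, -, rfl⟩ := List.mem_map.mp hx
      exact Algebra.subset_adjoin (Set.mem_range_self i)))⟩

/-- `D` is the dilation operator `D_t` on `L²_hol(a)`: it is the bounded linear operator with
`D (a_{i_1} ⋯ a_{i_n}) = e^{-nt} a_{i_1} ⋯ a_{i_n}` for every word (including the empty one). -/
def IsDilation {ι : Type*} (φ : FaithfulTrace A) (a : ι → A) (t : ℝ)
    (D : L2hol φ (Set.range a) →L[ℂ] L2hol φ (Set.range a)) : Prop :=
  ∀ w : List ι, D (word φ a w) = ((Real.exp (-(w.length : ℝ) * t) : ℝ) : ℂ) • word φ a w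

/-! ### Non-commutative `L^p` norms, for even `p` -/

/-- `‖x‖_p = φ(|x|^p)^{1/p}` for `x ∈ A` and even `p`, where `|x|^p = (x* x)^{p/2}`. -/
noncomputable def pNorm (φ : FaithfulTrace A) (p : ℕ) (x : A) : ℝ :=
  (φ ((star x * x) ^ (p / 2))).re ^ (1 / (p : ℝ))

/-- The norm of `L^p(N, φ)` (even `p ≥ 2`, `N ⊆ A` a `*`-subalgebra) on elements of `L²(A, φ)`, with
value `∞` off `L^p(N, φ)`. Here `L^p(N, φ)`, the completion of `N` for `‖·‖_p`, is realized inside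
`L²`: its elements are the `L²`-limits of sequences in `N` that are Cauchy for `‖·‖_p`, and the norm
of such a limit is the limit of the norms. -/
noncomputable def lpNorm (φ : FaithfulTrace A) (N : Set A) (p : ℕ) (ξ : L2 φ) : ℝ≥0∞ :=
  sInf {L : ℝ≥0∞ | ∃ x : ℕ → A, (∀ n, x n ∈ N) ∧
    (∀ ε > 0, ∃ K, ∀ m ≥ K, ∀ n ≥ K, pNorm φ p (x m - x n) < ε) ∧
    Tendsto (fun n => toL2 φ (x n)) atTop (𝓝 ξ) ∧
    Tendsto (fun n => ENNReal.ofReal (pNorm φ p (x n))) atTop (𝓝 L)}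

/-- The norm in `[0, ∞]` of the restriction `D : F → L^p(N, φ)` to a subspace `F` of the domain. -/
noncomputable def opNormLp (φ : FaithfulTrace A) (N : Set A) (p : ℕ) {E : Submodule ℂ (L2 φ)}
    (D : E →L[ℂ] E) (F : Submodule ℂ (L2 φ)) : ℝ≥0∞ :=
  ⨆ (ξ : E) (_ : (ξ : L2 φ) ∈ F) (_ : ‖ξ‖ ≤ 1), lpNorm φ N p (D ξ : L2 φ)

end Algebraic

/-! ### von Neumann algebras -/

section VonNeumann

variable {H : Type u} [NormedAddCommGroup H] [InnerProductSpace ℂ H] [CompleteSpace H]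

instance : SMulMemClass (VonNeumannAlgebra H) ℂ (H →L[ℂ] H) where
  smul_mem {M} c _ hx := M.toStarSubalgebra.smul_mem hx c

/-- `W*(S)`: the von Neumann algebra generated by `S ⊆ M`, i.e. the double commutant of `S ∪ S*`,
as a subset of `M`. -/
def wStar {M : VonNeumannAlgebra H} (S : Set M) : Set M :=
  {x | (x : H →L[ℂ] H) ∈
    Set.centralizer (Set.centralizer ((fun y : M => (y : H →L[ℂ] H)) '' (S ∪ star S)))}

/-- Normality: `φ` preserves suprema of upward directed sets (for the operator order). -/
def IsNormal {M : VonNeumannAlgebra H} (φ : FaithfulTrace M) : Prop :=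
  ∀ (S : Set M) (s : M), S.Nonempty → DirectedOn (· ≤ ·) S → IsLUB S s →
    IsLUB ((fun x => (φ x).re) '' S) (φ s).re

end VonNeumann

end FreeProb

/-!
The lower bound for `‖D_t ψ_t‖_p` rests on counting non-crossing pairings. Let `b` be the
normalization of the distinguished generator, `p = 2r` and `q = e^{-2t}`, so that
`D_t ψ_t = ∑ qⁿ bⁿ`.

*Orthogonality.* In a `*`-free family of `R`-diagonal elements every block with a non-zero cumulant
contains as many generators as adjoints of generators. Hence words of different lengths are
orthogonal (`inner_word_eq_zero`), `D_t = ∑ e^{-nt} P_n` with the projections `P_n` onto the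
homogeneous subspaces, and `‖ψ_t‖² ≤ 1 / (1 - q)`, because only the rainbow pairing contributes to
`φ (a*ⁿ aⁿ)` (`IsRDiagonal.moment_rainbow`).

*Positivity.* As the cumulants are non-negative, the moments of words in `b` and `b*` dominate the
numbers of non-crossing pairings of letters `b` with letters `b*`. Only two consequences of this are
needed, collected in `PairingBound`: they say that the partitions in which a given letter is paired
with a given partner contribute at least the product of the moments of the two sides of the chord,
and that the contributions of two different partners add up. They follow from an injection that
glues partitions of the two sides (`ChordSplit.glue`).

*Counting.* Let `s = ∑_{n ≤ N} qⁿ bⁿ`. Expanding, `φ ((s* s)^r)` is a sum over the exponents of the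
words `b*^n₁ b^n₂ ⋯ b*^n₂ᵣ₋₁ b^n₂ᵣ`. Of four consecutive blocks, the middle two can be paired off
completely, with `x`, `y`, `z` pairs between consecutive blocks; what remains is a word with two
blocks fewer, so each such reduction gains a factor `(∑ q^{2x})³`
(`PairingBound.geomSum_mul_blockSum_one_le`). Thus `φ ((s* s)^r)` is at least of order
`t^{-(3r-2)}`.

*Duality.* It is not known beforehand that `∑ qⁿ bⁿ` converges in `L^p`. Instead, the resolvent is
paired with `y = s (s* s)^{r-1}`: all terms of `⟨y, ∑ qⁿ bⁿ⟩` are non-negative and those with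
`n ≤ N` add up to `φ ((s* s)^r)`, so that Hölder's inequality gives `‖D_t ψ_t‖_p ≥ ‖s‖_p`
(`pNorm_truncResolvent_le_lpNorm`). The case of Hölder's inequality that is needed,
`|φ ((s* s)^{r-1} s* x)| ≤ ‖s‖_p^{p-1} ‖x‖_p`, is a chessboard estimate: it follows from the
Cauchy-Schwarz inequality by reflecting words of maximal moment (`chessboard`).

Comparing `‖s‖_p ≥ c t^{-3/2+2/p}` with `‖ψ_t‖₂ ≤ c' t^{-1/2}` gives the exponent `-1 + 2/p`.
-/

namespace FreeProb

/-! ### Moments and cumulants of blocks -/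

section MomentCumulant

variable {A : Type*} [Monoid A]

/-- The cumulant `κ_{|V|}[x_i : i ∈ V]` of a block `V`. -/
noncomputable def blockCumulant (φ : A → ℂ) {n : ℕ} (x : Fin n → A) (V : Finset (Fin n)) : ℂ :=
  freeCumulant φ V.card fun i => x (V.orderEmbOfFin rfl i)

/-- The contribution `∏_{V ∈ π} κ_{|V|}[x_i : i ∈ V]` of a partition to the moment of `x`. -/
noncomputable def partCumulant (φ : A → ℂ) {n : ℕ} (x : Fin n → A)
    (π : Finpartition (Finset.univ : Finset (Fin n))) : ℂ :=
  ∏ V ∈ π.parts, blockCumulant φ x V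

open Classical in
/-- The non-crossing partitions of `{0, …, n-1}`. -/
noncomputable def allNC (n : ℕ) : Finset (Finpartition (Finset.univ : Finset (Fin n))) :=
  Finset.univ.filter fun π => IsNonCrossing π

theorem mem_allNC {n : ℕ} {π : Finpartition (Finset.univ : Finset (Fin n))} :
    π ∈ allNC n ↔ IsNonCrossing π := by simp [allNC]

theorem freeCumulant_congr (φ : A → ℂ) {m n : ℕ} (h : m = n) {x : Fin m → A} {y : Fin n → A}
    (hxy : ∀ i, x i = y (Fin.cast h i)) : freeCumulant φ m x = freeCumulant φ n y := by
  subst h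
  congr 1
  funext i
  exact hxy i

theorem blockCumulant_map (φ : A → ℂ) {m n : ℕ} (e : Fin m ↪o Fin n) (x : Fin n → A)
    (V : Finset (Fin m)) :
    blockCumulant φ x (V.map e.toEmbedding) = blockCumulant φ (fun k => x (e k)) V := by
  have hc : V.card = (V.map e.toEmbedding).card := (Finset.card_map _).symm
  symm
  refine freeCumulant_congr φ hc fun i => ?_
  have h : (fun i => e (V.orderEmbOfFin rfl i)) =
      (V.map e.toEmbedding).orderEmbOfFin hc.symm :=
    Finset.orderEmbOfFin_unique _ (fun i => Finset.mem_map_of_mem _ (V.orderEmbOfFin_mem rfl i))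
      (e.strictMono.comp (V.orderEmbOfFin rfl).strictMono)
  exact congrArg x ((congrFun h i).trans
    (Finset.orderEmbOfFin_eq_orderEmbOfFin_iff.mpr rfl))

theorem blockCumulant_univ (φ : A → ℂ) {n : ℕ} (x : Fin n → A) :
    blockCumulant φ x Finset.univ = freeCumulant φ n x := by
  refine freeCumulant_congr φ (by simp) fun i => ?_
  have h : (fun i : Fin n => i) = (Finset.univ : Finset (Fin n)).orderEmbOfFin (by simp) :=
    Finset.orderEmbOfFin_unique _ (by simp) (fun _ _ h => h)
  have h2 : (Fin.cast (by simp) i : Fin n) =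
      (Finset.univ : Finset (Fin n)).orderEmbOfFin rfl i :=
    (congrFun h (Fin.cast (by simp) i)).trans
      (Finset.orderEmbOfFin_eq_orderEmbOfFin_iff.mpr rfl)
  exact congrArg x h2.symm

theorem freeCumulant_eq (φ : A → ℂ) (n : ℕ) (x : Fin n → A) :
    freeCumulant φ n x = φ (List.ofFn x).prod - ∑ π ∈ properNC n, partCumulant φ x π := by
  rw [freeCumulant, ← Finset.sum_attach (properNC n)]
  congr 1
  refine Finset.sum_congr rfl fun π _ => ?_
  exact Finset.prod_attach _ fun V : Finset (Fin n) =>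
    freeCumulant φ V.card fun i => x (V.orderEmbOfFin rfl i)

/-- The moment-cumulant formula. In length `0` it is the normalization `φ 1 = 1`. -/
theorem moment_eq_sum_partCumulant (φ : A → ℂ) (h1 : φ 1 = 1) {n : ℕ} (x : Fin n → A) :
    φ (List.ofFn x).prod = ∑ π ∈ allNC n, partCumulant φ x π := by
  classical
  rcases Nat.eq_zero_or_pos n with rfl | hn
  · have hall : allNC 0 = Finset.univ := by
      ext π
      simp only [mem_allNC, Finset.mem_univ, iff_true]
      intro B _ C _ i
      exact i.elim0
    have hp : ∀ π : Finpartition (Finset.univ : Finset (Fin 0)), π.parts = ∅ := by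
      intro π
      refine Finset.eq_empty_of_forall_notMem fun V hV => ?_
      obtain ⟨i, _⟩ := π.nonempty_of_mem_parts hV
      exact i.elim0
    have hcard : Fintype.card (Finpartition (Finset.univ : Finset (Fin 0))) = 1 := by
      rw [Fintype.card_eq_one_iff]
      refine ⟨⊥, fun y => Finpartition.ext ?_⟩
      rw [hp, hp]
    simp only [hall, partCumulant, hp, List.ofFn_zero, List.prod_nil, h1, Finset.prod_empty,
      Finset.sum_const, Finset.card_univ, hcard, one_smul]
  · have : Nonempty (Fin n) := ⟨⟨0, hn⟩⟩
    have hne : (Finset.univ : Finset (Fin n)) ≠ ⊥ := Finset.univ_nonempty.ne_empty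
    have hsplit : allNC n = insert (Finpartition.indiscrete hne) (properNC n) := by
      ext π
      simp only [mem_allNC, Finset.mem_insert, properNC, Finset.mem_filter, Finset.mem_univ,
        true_and]
      constructor
      · intro h
        by_cases hu : Finset.univ ∈ π.parts
        · left
          refine Finpartition.ext (Finset.ext fun V => ?_)
          rw [Finpartition.indiscrete_parts, Finset.mem_singleton]
          refine ⟨fun hV => ?_, fun hV => hV ▸ hu⟩
          by_contra hVu
          obtain ⟨i, hi⟩ := π.nonempty_of_mem_parts hV
          exact Finset.disjoint_left.mp (π.disjoint hV hu hVu) hi (Finset.mem_univ i)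
        · exact Or.inr ⟨h, hu⟩
      · rintro (rfl | h)
        · intro B hB C hC
          rw [Finpartition.indiscrete_parts, Finset.mem_singleton] at hB hC
          intros
          rw [hB, hC]
        · exact h.1
    have hnot : Finpartition.indiscrete hne ∉ properNC n := by
      simp [properNC]
    rw [hsplit, Finset.sum_insert hnot]
    have : partCumulant φ x (Finpartition.indiscrete hne) = freeCumulant φ n x := by
      rw [partCumulant, Finpartition.indiscrete_parts, Finset.prod_singleton, blockCumulant_univ]
    rw [this, freeCumulant_eq]
    ring

end MomentCumulant

/-! ### Non-crossing partitions on the two sides of a chord -/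

section Gluing

/-- A chord `{i, j}` of `{0, …, n-1}`, with increasing enumerations of its two sides: `inner` of the
points strictly between `i` and `j`, and `outer` of the points before `i` or after `j`. -/
structure ChordSplit (p q n : ℕ) where
  i : Fin n
  j : Fin n
  hij : i < j
  inner : Fin p ↪o Fin n
  outer : Fin q ↪o Fin n
  mem_inner : ∀ k, (i < k ∧ k < j) ↔ k ∈ Set.range inner
  mem_outer : ∀ k, (k < i ∨ j < k) ↔ k ∈ Set.range outer

namespace ChordSplit

variable {p q n : ℕ} (c : ChordSplit p q n)

/-- The blocks of the partition glued from partitions of the two sides of a chord. -/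
def parts (π : Finpartition (Finset.univ : Finset (Fin p)))
    (ρ : Finpartition (Finset.univ : Finset (Fin q))) : Finset (Finset (Fin n)) :=
  insert {c.i, c.j} (π.parts.map (Finset.mapEmbedding c.inner.toEmbedding).toEmbedding ∪
    ρ.parts.map (Finset.mapEmbedding c.outer.toEmbedding).toEmbedding)

theorem mem_parts {π : Finpartition (Finset.univ : Finset (Fin p))}
    {ρ : Finpartition (Finset.univ : Finset (Fin q))} {V : Finset (Fin n)} :
    V ∈ c.parts π ρ ↔ V = {c.i, c.j} ∨ (∃ U ∈ π.parts, U.map c.inner.toEmbedding = V) ∨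
      ∃ U ∈ ρ.parts, U.map c.outer.toEmbedding = V := by
  simp [parts, Finset.mapEmbedding_apply]

theorem inner_bounds (k : Fin p) : c.i < c.inner k ∧ c.inner k < c.j :=
  (c.mem_inner _).mpr ⟨k, rfl⟩

theorem outer_bounds (k : Fin q) : c.outer k < c.i ∨ c.j < c.outer k :=
  (c.mem_outer _).mpr ⟨k, rfl⟩

/-- The partition glued from partitions of the two sides of a chord. -/
def glue (π : Finpartition (Finset.univ : Finset (Fin p)))
    (ρ : Finpartition (Finset.univ : Finset (Fin q))) :
    Finpartition (Finset.univ : Finset (Fin n)) :=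
  Finpartition.ofExistsUnique (c.parts π ρ) (fun _ _ => Finset.subset_univ _)
    (by
      intro a _
      have hij := c.hij
      rcases lt_trichotomy a c.i with h | h | h
      · obtain ⟨k, hk⟩ := (c.mem_outer a).mp (Or.inl h)
        obtain ⟨U, ⟨hU, hkU⟩, huniq⟩ := ρ.existsUnique_mem (Finset.mem_univ k)
        refine ⟨U.map c.outer.toEmbedding, ⟨c.mem_parts.mpr (Or.inr (Or.inr ⟨U, hU, rfl⟩)),
          Finset.mem_map.mpr ⟨k, hkU, hk⟩⟩, ?_⟩
        rintro V ⟨hV, haV⟩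
        rcases c.mem_parts.mp hV with rfl | ⟨W, hW, rfl⟩ | ⟨W, hW, rfl⟩
        · simp only [Finset.mem_insert, Finset.mem_singleton] at haV
          rcases haV with rfl | rfl
          · exact absurd h (lt_irrefl _)
          · exact absurd (h.trans hij) (lt_irrefl _)
        · obtain ⟨l, _, hl⟩ := Finset.mem_map.mp haV
          have := c.inner_bounds l
          have hl' : c.inner l = a := hl
          rw [hl'] at this
          exact absurd (h.trans this.1) (lt_irrefl _)
        · obtain ⟨l, hlW, hl⟩ := Finset.mem_map.mp haV
          have hlk : l = k := c.outer.injective (hl.trans hk.symm)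
          rw [huniq W ⟨hW, hlk ▸ hlW⟩]
      · refine ⟨{c.i, c.j}, ⟨c.mem_parts.mpr (Or.inl rfl), by simp [h]⟩, ?_⟩
        rintro V ⟨hV, haV⟩
        rcases c.mem_parts.mp hV with rfl | ⟨W, hW, rfl⟩ | ⟨W, hW, rfl⟩
        · rfl
        · obtain ⟨l, _, hl⟩ := Finset.mem_map.mp haV
          have := c.inner_bounds l
          have hl' : c.inner l = a := hl
          rw [hl', h] at this
          exact absurd this.1 (lt_irrefl _)
        · obtain ⟨l, _, hl⟩ := Finset.mem_map.mp haV
          have := c.outer_bounds l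
          have hl' : c.outer l = a := hl
          rw [hl', h] at this
          rcases this with h' | h'
          · exact absurd h' (lt_irrefl _)
          · exact absurd (hij.trans h') (lt_irrefl _)
      · rcases lt_trichotomy a c.j with h2 | h2 | h2
        · obtain ⟨k, hk⟩ := (c.mem_inner a).mp ⟨h, h2⟩
          obtain ⟨U, ⟨hU, hkU⟩, huniq⟩ := π.existsUnique_mem (Finset.mem_univ k)
          refine ⟨U.map c.inner.toEmbedding, ⟨c.mem_parts.mpr (Or.inr (Or.inl ⟨U, hU, rfl⟩)),
            Finset.mem_map.mpr ⟨k, hkU, hk⟩⟩, ?_⟩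
          rintro V ⟨hV, haV⟩
          rcases c.mem_parts.mp hV with rfl | ⟨W, hW, rfl⟩ | ⟨W, hW, rfl⟩
          · simp only [Finset.mem_insert, Finset.mem_singleton] at haV
            rcases haV with rfl | rfl
            · exact absurd h (lt_irrefl _)
            · exact absurd h2 (lt_irrefl _)
          · obtain ⟨l, hlW, hl⟩ := Finset.mem_map.mp haV
            have hlk : l = k := c.inner.injective (hl.trans hk.symm)
            rw [huniq W ⟨hW, hlk ▸ hlW⟩]
          · obtain ⟨l, _, hl⟩ := Finset.mem_map.mp haV
            have := c.outer_bounds l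
            have hl' : c.outer l = a := hl
            rw [hl'] at this
            rcases this with h' | h'
            · exact absurd (h.trans h') (lt_irrefl _)
            · exact absurd (h2.trans h') (lt_irrefl _)
        · refine ⟨{c.i, c.j}, ⟨c.mem_parts.mpr (Or.inl rfl), by simp [h2]⟩, ?_⟩
          rintro V ⟨hV, haV⟩
          rcases c.mem_parts.mp hV with rfl | ⟨W, hW, rfl⟩ | ⟨W, hW, rfl⟩
          · rfl
          · obtain ⟨l, _, hl⟩ := Finset.mem_map.mp haV
            have := c.inner_bounds l
            have hl' : c.inner l = a := hl
            rw [hl', h2] at this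
            exact absurd this.2 (lt_irrefl _)
          · obtain ⟨l, _, hl⟩ := Finset.mem_map.mp haV
            have := c.outer_bounds l
            have hl' : c.outer l = a := hl
            rw [hl', h2] at this
            rcases this with h' | h'
            · exact absurd (hij.trans h') (lt_irrefl _)
            · exact absurd h' (lt_irrefl _)
        · obtain ⟨k, hk⟩ := (c.mem_outer a).mp (Or.inr h2)
          obtain ⟨U, ⟨hU, hkU⟩, huniq⟩ := ρ.existsUnique_mem (Finset.mem_univ k)
          refine ⟨U.map c.outer.toEmbedding, ⟨c.mem_parts.mpr (Or.inr (Or.inr ⟨U, hU, rfl⟩)),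
            Finset.mem_map.mpr ⟨k, hkU, hk⟩⟩, ?_⟩
          rintro V ⟨hV, haV⟩
          rcases c.mem_parts.mp hV with rfl | ⟨W, hW, rfl⟩ | ⟨W, hW, rfl⟩
          · simp only [Finset.mem_insert, Finset.mem_singleton] at haV
            rcases haV with rfl | rfl
            · exact absurd h (lt_irrefl _)
            · exact absurd h2 (lt_irrefl _)
          · obtain ⟨l, _, hl⟩ := Finset.mem_map.mp haV
            have := c.inner_bounds l
            have hl' : c.inner l = a := hl
            rw [hl'] at this
            exact absurd (h2.trans this.2) (lt_irrefl _)
          · obtain ⟨l, hlW, hl⟩ := Finset.mem_map.mp haV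
            have hlk : l = k := c.outer.injective (hl.trans hk.symm)
            rw [huniq W ⟨hW, hlk ▸ hlW⟩])
    (by
      intro h
      rcases c.mem_parts.mp h with h | ⟨W, hW, h⟩ | ⟨W, hW, h⟩
      · exact (Finset.insert_nonempty _ _).ne_empty h.symm
      · exact (π.nonempty_of_mem_parts hW).ne_empty (Finset.map_eq_empty.mp h)
      · exact (ρ.nonempty_of_mem_parts hW).ne_empty (Finset.map_eq_empty.mp h))

theorem glue_parts (π : Finpartition (Finset.univ : Finset (Fin p)))
    (ρ : Finpartition (Finset.univ : Finset (Fin q))) : (c.glue π ρ).parts = c.parts π ρ := rfl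

theorem glue_isNonCrossing {π : Finpartition (Finset.univ : Finset (Fin p))}
    {ρ : Finpartition (Finset.univ : Finset (Fin q))} (hπ : IsNonCrossing π)
    (hρ : IsNonCrossing ρ) : IsNonCrossing (c.glue π ρ) := by
  intro B hB C hC i hi j hj k hk l hl h1 h2 h3
  have hij := c.hij
  rw [glue_parts] at hB hC
  rcases c.mem_parts.mp hB with rfl | ⟨B, hB, rfl⟩ | ⟨B, hB, rfl⟩ <;>
  rcases c.mem_parts.mp hC with rfl | ⟨C, hC, rfl⟩ | ⟨C, hC, rfl⟩
  · rfl
  · obtain ⟨j, hj, rfl⟩ := Finset.mem_map.mp hj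
    obtain ⟨l, hl, rfl⟩ := Finset.mem_map.mp hl
    have b1 := c.inner_bounds j
    have b2 := c.inner_bounds l
    simp only [Finset.mem_insert, Finset.mem_singleton, RelEmbedding.coe_toEmbedding] at *
    rcases hi with rfl | rfl <;> rcases hk with rfl | rfl <;> omega
  · obtain ⟨j, hj, rfl⟩ := Finset.mem_map.mp hj
    obtain ⟨l, hl, rfl⟩ := Finset.mem_map.mp hl
    have b1 := c.outer_bounds j
    have b2 := c.outer_bounds l
    simp only [Finset.mem_insert, Finset.mem_singleton, RelEmbedding.coe_toEmbedding] at *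
    rcases hi with rfl | rfl <;> rcases hk with rfl | rfl <;> omega
  · obtain ⟨i, hi, rfl⟩ := Finset.mem_map.mp hi
    obtain ⟨k, hk, rfl⟩ := Finset.mem_map.mp hk
    have b1 := c.inner_bounds i
    have b2 := c.inner_bounds k
    simp only [Finset.mem_insert, Finset.mem_singleton, RelEmbedding.coe_toEmbedding] at *
    rcases hj with rfl | rfl <;> rcases hl with rfl | rfl <;> omega
  · obtain ⟨i, hi', rfl⟩ := Finset.mem_map.mp hi
    obtain ⟨j, hj', rfl⟩ := Finset.mem_map.mp hj
    obtain ⟨k, hk', rfl⟩ := Finset.mem_map.mp hk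
    obtain ⟨l, hl', rfl⟩ := Finset.mem_map.mp hl
    rw [hπ B ‹_› C ‹_› i hi' j hj' k hk' l hl' (c.inner.lt_iff_lt.mp h1) (c.inner.lt_iff_lt.mp h2)
      (c.inner.lt_iff_lt.mp h3)]
  · obtain ⟨i, hi, rfl⟩ := Finset.mem_map.mp hi
    obtain ⟨j, hj, rfl⟩ := Finset.mem_map.mp hj
    obtain ⟨k, hk, rfl⟩ := Finset.mem_map.mp hk
    have b1 := c.inner_bounds i
    have b2 := c.inner_bounds k
    have b3 := c.outer_bounds j
    simp only [RelEmbedding.coe_toEmbedding] at *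
    omega
  · obtain ⟨i, hi, rfl⟩ := Finset.mem_map.mp hi
    obtain ⟨k, hk, rfl⟩ := Finset.mem_map.mp hk
    have b1 := c.outer_bounds i
    have b2 := c.outer_bounds k
    simp only [Finset.mem_insert, Finset.mem_singleton, RelEmbedding.coe_toEmbedding] at *
    rcases hj with rfl | rfl <;> rcases hl with rfl | rfl <;> omega
  · obtain ⟨j, hj, rfl⟩ := Finset.mem_map.mp hj
    obtain ⟨k, hk, rfl⟩ := Finset.mem_map.mp hk
    obtain ⟨l, hl, rfl⟩ := Finset.mem_map.mp hl
    have b1 := c.inner_bounds j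
    have b2 := c.inner_bounds l
    have b3 := c.outer_bounds k
    simp only [RelEmbedding.coe_toEmbedding] at *
    omega
  · obtain ⟨i, hi', rfl⟩ := Finset.mem_map.mp hi
    obtain ⟨j, hj', rfl⟩ := Finset.mem_map.mp hj
    obtain ⟨k, hk', rfl⟩ := Finset.mem_map.mp hk
    obtain ⟨l, hl', rfl⟩ := Finset.mem_map.mp hl
    rw [hρ B ‹_› C ‹_› i hi' j hj' k hk' l hl' (c.outer.lt_iff_lt.mp h1) (c.outer.lt_iff_lt.mp h2)
      (c.outer.lt_iff_lt.mp h3)]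

theorem map_inner_ne_map_outer {π : Finpartition (Finset.univ : Finset (Fin p))}
    {U : Finset (Fin p)} (hU : U ∈ π.parts) (W : Finset (Fin q)) :
    U.map c.inner.toEmbedding ≠ W.map c.outer.toEmbedding := by
  intro h
  obtain ⟨k, hk⟩ := π.nonempty_of_mem_parts hU
  have h1 : c.inner k ∈ W.map c.outer.toEmbedding := h ▸ Finset.mem_map_of_mem _ hk
  obtain ⟨l, _, hl⟩ := Finset.mem_map.mp h1
  have hl' : c.outer l = c.inner k := hl
  have b1 := c.inner_bounds k
  have b2 := c.outer_bounds l
  rw [hl'] at b2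
  omega

theorem chord_ne_map_inner (U : Finset (Fin p)) : {c.i, c.j} ≠ U.map c.inner.toEmbedding := by
  intro h
  have h1 : c.i ∈ U.map c.inner.toEmbedding := h ▸ by simp
  obtain ⟨l, _, hl⟩ := Finset.mem_map.mp h1
  have hl' : c.inner l = c.i := hl
  have b1 := c.inner_bounds l
  rw [hl'] at b1
  omega

theorem chord_ne_map_outer (U : Finset (Fin q)) : {c.i, c.j} ≠ U.map c.outer.toEmbedding := by
  intro h
  have hij := c.hij
  have h1 : c.i ∈ U.map c.outer.toEmbedding := h ▸ by simp
  obtain ⟨l, _, hl⟩ := Finset.mem_map.mp h1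
  have hl' : c.outer l = c.i := hl
  have b1 := c.outer_bounds l
  rw [hl'] at b1
  omega

theorem glue_injective {π π' : Finpartition (Finset.univ : Finset (Fin p))}
    {ρ ρ' : Finpartition (Finset.univ : Finset (Fin q))} (h : c.glue π ρ = c.glue π' ρ') :
    π = π' ∧ ρ = ρ' := by
  have hp : c.parts π ρ = c.parts π' ρ' := congrArg Finpartition.parts h
  have key1 : ∀ {π π' : Finpartition (Finset.univ : Finset (Fin p))}
      {ρ ρ' : Finpartition (Finset.univ : Finset (Fin q))}, c.parts π ρ = c.parts π' ρ' →
      ∀ U ∈ π.parts, U ∈ π'.parts := by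
    intro π π' ρ ρ' hp U hU
    have hm : U.map c.inner.toEmbedding ∈ c.parts π' ρ' :=
      hp ▸ c.mem_parts.mpr (Or.inr (Or.inl ⟨U, hU, rfl⟩))
    rcases c.mem_parts.mp hm with h | ⟨W, hW, h⟩ | ⟨W, hW, h⟩
    · exact absurd h.symm (c.chord_ne_map_inner U)
    · rwa [← Finset.map_injective _ h]
    · exact absurd h.symm (c.map_inner_ne_map_outer hU W)
  have key2 : ∀ {π π' : Finpartition (Finset.univ : Finset (Fin p))}
      {ρ ρ' : Finpartition (Finset.univ : Finset (Fin q))}, c.parts π ρ = c.parts π' ρ' →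
      ∀ U ∈ ρ.parts, U ∈ ρ'.parts := by
    intro π π' ρ ρ' hp U hU
    have hm : U.map c.outer.toEmbedding ∈ c.parts π' ρ' :=
      hp ▸ c.mem_parts.mpr (Or.inr (Or.inr ⟨U, hU, rfl⟩))
    rcases c.mem_parts.mp hm with h | ⟨W, hW, h⟩ | ⟨W, hW, h⟩
    · exact absurd h.symm (c.chord_ne_map_outer U)
    · exact absurd h (c.map_inner_ne_map_outer hW U)
    · rwa [← Finset.map_injective _ h]
  exact ⟨Finpartition.ext (Finset.ext fun U => ⟨key1 hp U, key1 hp.symm U⟩),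
    Finpartition.ext (Finset.ext fun U => ⟨key2 hp U, key2 hp.symm U⟩)⟩

theorem partCumulant_glue {A : Type*} [Monoid A] (φ : A → ℂ) (x : Fin n → A)
    (π : Finpartition (Finset.univ : Finset (Fin p)))
    (ρ : Finpartition (Finset.univ : Finset (Fin q))) :
    partCumulant φ x (c.glue π ρ) = blockCumulant φ x {c.i, c.j} *
      (partCumulant φ (fun k => x (c.inner k)) π * partCumulant φ (fun k => x (c.outer k)) ρ) := by
  rw [partCumulant, glue_parts, parts, Finset.prod_insert, Finset.prod_union, Finset.prod_map,
    Finset.prod_map]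
  · simp only [RelEmbedding.coe_toEmbedding, Finset.mapEmbedding_apply, blockCumulant_map]
    rfl
  · rw [Finset.disjoint_left]
    intro V hV hV'
    simp only [Finset.mem_map, RelEmbedding.coe_toEmbedding, Finset.mapEmbedding_apply] at hV hV'
    obtain ⟨U, hU, rfl⟩ := hV
    obtain ⟨W, _, h⟩ := hV'
    exact c.map_inner_ne_map_outer hU W h.symm
  · simp only [Finset.mem_union, Finset.mem_map, RelEmbedding.coe_toEmbedding,
      Finset.mapEmbedding_apply]
    rintro (⟨U, _, h⟩ | ⟨U, _, h⟩)
    · exact c.chord_ne_map_inner U h.symm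
    · exact c.chord_ne_map_outer U h.symm

open Classical in
/-- When all partitions contribute non-negatively, those having `{i, j}` as a block contribute at
least the cumulant of that block times the moments of the two sides. -/
theorem le_sum_partCumulant {A : Type*} [Monoid A] (φ : A → ℂ) (h1 : φ 1 = 1) (x : Fin n → A)
    (hx : ∀ V, 0 ≤ blockCumulant φ x V) :
    blockCumulant φ x {c.i, c.j} * (φ (List.ofFn fun k => x (c.inner k)).prod *
      φ (List.ofFn fun k => x (c.outer k)).prod) ≤
      ∑ π ∈ (allNC n).filter (fun π => {c.i, c.j} ∈ π.parts), partCumulant φ x π := by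
  rw [moment_eq_sum_partCumulant φ h1, moment_eq_sum_partCumulant φ h1, Finset.sum_mul_sum,
    ← Finset.sum_product', Finset.mul_sum]
  simp only [← c.partCumulant_glue]
  rw [← Finset.sum_image (g := fun πρ : _ × _ => c.glue πρ.1 πρ.2) (f := partCumulant φ x)]
  · refine Finset.sum_le_sum_of_subset_of_nonneg ?_ fun π _ _ =>
      Finset.prod_nonneg fun V _ => hx V
    intro π hπ
    obtain ⟨⟨π, ρ⟩, h, rfl⟩ := Finset.mem_image.mp hπ
    obtain ⟨ha, hb⟩ := Finset.mem_product.mp h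
    refine Finset.mem_filter.mpr ⟨mem_allNC.mpr ?_, c.mem_parts.mpr (Or.inl rfl)⟩
    exact c.glue_isNonCrossing (mem_allNC.mp ha) (mem_allNC.mp hb)
  · rintro ⟨π, ρ⟩ _ ⟨π', ρ'⟩ _ h
    obtain ⟨h, h'⟩ := c.glue_injective h
    exact Prod.ext h h'

end ChordSplit

end Gluing

/-! ### Chords in words -/

section Words

variable {A L : Type*}

theorem ofFn_map_getElem (f : L → A) (l : List L) :
    List.ofFn (fun k : Fin l.length => f l[(k : ℕ)]) = l.map f := by
  apply List.ext_getElem <;> simp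

theorem chordOfWord_inner_lt {P B D : List L} {s t : L} (k : Fin B.length) :
    P.length + 1 + (k : ℕ) < (P ++ s :: (B ++ t :: D)).length := by
  simp
  omega

theorem chordOfWord_outer_lt {P B D : List L} {s t : L} (k : Fin (P ++ D).length) :
    (if (k : ℕ) < P.length then (k : ℕ) else k + B.length + 2) <
      (P ++ s :: (B ++ t :: D)).length := by
  have := k.2
  simp only [List.length_append, List.length_cons] at *
  split_ifs <;> omega

/-- The positions of the factor `B` in the word `P s B t D`. -/
def innerPos (P B D : List L) (s t : L) :
    Fin B.length ↪o Fin (P ++ s :: (B ++ t :: D)).length :=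
  OrderEmbedding.ofMapLEIff (fun k => ⟨P.length + 1 + k, chordOfWord_inner_lt k⟩) fun k l => by
    simp only [Fin.le_def]; omega

/-- The positions of the factors `P` and `D` in the word `P s B t D`. -/
def outerPos (P B D : List L) (s t : L) :
    Fin (P ++ D).length ↪o Fin (P ++ s :: (B ++ t :: D)).length :=
  OrderEmbedding.ofMapLEIff
    (fun k => ⟨if (k : ℕ) < P.length then k else k + B.length + 2, chordOfWord_outer_lt k⟩)
    fun k l => by simp only [Fin.le_def]; split_ifs <;> omega

theorem innerPos_val (P B D : List L) (s t : L) (k : Fin B.length) :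
    (innerPos P B D s t k : ℕ) = P.length + 1 + k := rfl

theorem outerPos_val (P B D : List L) (s t : L) (k : Fin (P ++ D).length) :
    (outerPos P B D s t k : ℕ) = if (k : ℕ) < P.length then (k : ℕ) else k + B.length + 2 := rfl

/-- The chord joining the letters `s` and `t` of the word `P s B t D`. -/
def chordOfWord (P B D : List L) (s t : L) :
    ChordSplit B.length (P ++ D).length (P ++ s :: (B ++ t :: D)).length where
  i := ⟨P.length, by simp⟩
  j := ⟨P.length + B.length + 1, by simp; omega⟩
  hij := by simp only [Fin.lt_def]; omega
  inner := innerPos P B D s t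
  outer := outerPos P B D s t
  mem_inner := by
    intro k
    have hk := k.2
    simp only [List.length_append, List.length_cons] at hk
    simp only [Fin.lt_def, Set.mem_range, Fin.ext_iff, innerPos_val]
    constructor
    · intro h
      exact ⟨⟨k - P.length - 1, by omega⟩, by simp only; omega⟩
    · rintro ⟨l, hl⟩
      omega
  mem_outer := by
    intro k
    have hk := k.2
    simp only [List.length_append, List.length_cons] at hk
    simp only [Fin.lt_def, Set.mem_range, Fin.ext_iff, outerPos_val]
    constructor
    · rintro (h | h)
      · exact ⟨⟨k, by simp only [List.length_append]; omega⟩, by simp only; rw [if_pos h]⟩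
      · exact ⟨⟨k - B.length - 2, by simp only [List.length_append]; omega⟩, by
          simp only; rw [if_neg] <;> omega⟩
    · rintro ⟨l, hl⟩
      split_ifs at hl <;> omega

/-- The function of positions associated with a word in letters that stand for elements of `A`. -/
def letters (f : L → A) (l : List L) : Fin l.length → A := fun k => f l[(k : ℕ)]

theorem ofFn_letters (f : L → A) (l : List L) : List.ofFn (letters f l) = l.map f :=
  ofFn_map_getElem f l

theorem ofFn_chordOfWord_inner (f : L → A) (P B D : List L) (s t : L) :
    (List.ofFn fun k => letters f (P ++ s :: (B ++ t :: D)) ((chordOfWord P B D s t).inner k)) =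
      B.map f := by
  rw [← ofFn_map_getElem]
  congr 1
  funext k
  refine congrArg f ?_
  have : (((chordOfWord P B D s t).inner k : Fin _) : ℕ) = P.length + 1 + k := rfl
  simp only [this]
  have e : P ++ s :: (B ++ t :: D) = (P ++ [s]) ++ (B ++ t :: D) := by simp
  simp only [e]
  rw [List.getElem_append_right (by simp), List.getElem_append_left (by simp)]
  simp

theorem ofFn_chordOfWord_outer (f : L → A) (P B D : List L) (s t : L) :
    (List.ofFn fun k => letters f (P ++ s :: (B ++ t :: D)) ((chordOfWord P B D s t).outer k)) =
      (P ++ D).map f := by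
  rw [← ofFn_map_getElem]
  congr 1
  funext k
  refine congrArg f ?_
  have hk := k.2
  simp only [List.length_append] at hk
  have : (((chordOfWord P B D s t).outer k : Fin _) : ℕ) =
    if (k : ℕ) < P.length then (k : ℕ) else k + B.length + 2 := rfl
  simp only [this]
  by_cases h : (k : ℕ) < P.length
  · simp only [h, if_true]
    rw [List.getElem_append_left h, List.getElem_append_left h]
  · have e : P ++ s :: (B ++ t :: D) = (P ++ s :: B ++ [t]) ++ D := by simp
    simp only [h, if_false, e]
    rw [List.getElem_append_right (by simp; omega), List.getElem_append_right (by omega)]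
    congr 1
    simp
    omega

variable [Monoid A]

theorem blockCumulant_pair (φ : A → ℂ) {n : ℕ} (x : Fin n → A) {i j : Fin n} (hij : i < j) :
    blockCumulant φ x {i, j} = freeCumulant φ 2 ![x i, x j] := by
  refine freeCumulant_congr φ (Finset.card_pair hij.ne) fun k => ?_
  have h : (![i, j] : Fin 2 → Fin n) =
      ({i, j} : Finset (Fin n)).orderEmbOfFin (Finset.card_pair hij.ne) := by
    refine Finset.orderEmbOfFin_unique _ (fun k => ?_) ?_
    · fin_cases k <;> simp
    · intro k l hkl
      fin_cases k <;> fin_cases l <;> simp_all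
  have h2 : ({i, j} : Finset (Fin n)).orderEmbOfFin rfl k =
      (![i, j] : Fin 2 → Fin n) (Fin.cast (Finset.card_pair hij.ne) k) := by
    rw [h]
    exact Finset.orderEmbOfFin_eq_orderEmbOfFin_iff.mpr rfl
  rw [h2]
  generalize Fin.cast (Finset.card_pair hij.ne) k = k
  fin_cases k <;> rfl

/-- The two-element set `{i, j}` of positions is a block of `π`. -/
def HasPair {n : ℕ} (π : Finpartition (Finset.univ : Finset (Fin n))) (i j : ℕ) : Prop :=
  ∃ V ∈ π.parts, V.map Fin.valEmbedding = {i, j}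

theorem HasPair.not_hasPair {n : ℕ} {π : Finpartition (Finset.univ : Finset (Fin n))} {i j k : ℕ}
    (h : HasPair π i j) (hij : i < j) (hjk : j < k) : ¬ HasPair π j k := by
  rintro ⟨W, hW, hWe⟩
  obtain ⟨V, hV, hVe⟩ := h
  have hjV : j ∈ V.map Fin.valEmbedding := by rw [hVe]; simp
  have hjW : j ∈ W.map Fin.valEmbedding := by rw [hWe]; simp
  obtain ⟨x, hx, hxj⟩ := Finset.mem_map.mp hjV
  obtain ⟨y, hy, hyj⟩ := Finset.mem_map.mp hjW
  have hxy : x = y := Fin.valEmbedding.injective (hxj.trans hyj.symm)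
  have hVW : V = W := by
    by_contra hne
    exact Finset.disjoint_left.mp (π.disjoint hV hW hne) hx (hxy ▸ hy)
  rw [hVW, hWe] at hVe
  have : i ∈ ({j, k} : Finset ℕ) := hVe ▸ by simp
  simp only [Finset.mem_insert, Finset.mem_singleton] at this
  omega

open Classical in
theorem le_sum_partCumulant_hasPair {φ : A → ℂ} (h1 : φ 1 = 1) {f : L → A}
    (hx : ∀ l V, 0 ≤ blockCumulant φ (letters f l) V) {l P B D : List L} {s t : L}
    (hl : l = P ++ s :: (B ++ t :: D)) :
    freeCumulant φ 2 ![f s, f t] * (φ (B.map f).prod * φ ((P ++ D).map f).prod) ≤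
      ∑ π ∈ (allNC l.length).filter (fun π => HasPair π P.length (P.length + B.length + 1)),
        partCumulant φ (letters f l) π := by
  subst hl
  have h := (chordOfWord P B D s t).le_sum_partCumulant φ h1
    (letters f (P ++ s :: (B ++ t :: D))) (hx _)
  rw [blockCumulant_pair _ _ (chordOfWord P B D s t).hij, ofFn_chordOfWord_inner,
    ofFn_chordOfWord_outer] at h
  have hs : letters f (P ++ s :: (B ++ t :: D)) (chordOfWord P B D s t).i = f s := by
    simp [letters, chordOfWord]
  have ht : letters f (P ++ s :: (B ++ t :: D)) (chordOfWord P B D s t).j = f t := by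
    have e : P ++ s :: (B ++ t :: D) = (P ++ s :: B) ++ t :: D := by simp
    simp only [letters, chordOfWord, e]
    rw [List.getElem_append_right (by simp; omega)]
    simp
  rw [hs, ht] at h
  refine h.trans (Finset.sum_le_sum_of_subset_of_nonneg ?_ fun π _ _ =>
      Finset.prod_nonneg fun V _ => hx _ V)
  intro π hπ
  rw [Finset.mem_filter] at hπ ⊢
  refine ⟨hπ.1, _, hπ.2, ?_⟩
  rw [Finset.map_insert, Finset.map_singleton]
  rfl

theorem moment_word_eq {φ : A → ℂ} (h1 : φ 1 = 1) (f : L → A) (l : List L) :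
    φ (l.map f).prod = ∑ π ∈ allNC l.length, partCumulant φ (letters f l) π := by
  rw [← ofFn_letters, moment_eq_sum_partCumulant φ h1]

theorem moment_word_nonneg {φ : A → ℂ} (h1 : φ 1 = 1) {f : L → A}
    (hx : ∀ l V, 0 ≤ blockCumulant φ (letters f l) V) (l : List L) : 0 ≤ φ (l.map f).prod := by
  rw [moment_word_eq h1]
  exact Finset.sum_nonneg fun π _ => Finset.prod_nonneg fun V _ => hx _ V

/-- Non-negative cumulants: the partitions in which two given letters form a block bound the
moment from below. -/
theorem moment_chord_le {φ : A → ℂ} (h1 : φ 1 = 1) {f : L → A}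
    (hx : ∀ l V, 0 ≤ blockCumulant φ (letters f l) V) (P B D : List L) (s t : L) :
    freeCumulant φ 2 ![f s, f t] * (φ (B.map f).prod * φ ((P ++ D).map f).prod) ≤
      φ ((P ++ s :: (B ++ t :: D)).map f).prod := by
  classical
  refine (le_sum_partCumulant_hasPair h1 hx rfl).trans ?_
  rw [moment_word_eq h1]
  exact Finset.sum_le_sum_of_subset_of_nonneg (Finset.filter_subset _ _) fun π _ _ =>
    Finset.prod_nonneg fun V _ => hx _ V

/-- Non-negative cumulants: a letter `t` cannot be paired with two different letters by the same
partition, so the lower bounds coming from two possible partners of `t` add up. -/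
theorem moment_two_chords_le {φ : A → ℂ} (h1 : φ 1 = 1) {f : L → A}
    (hx : ∀ l V, 0 ≤ blockCumulant φ (letters f l) V) (P B C D : List L) (s t s' : L) :
    freeCumulant φ 2 ![f s, f t] * (φ (B.map f).prod * φ ((P ++ (C ++ s' :: D)).map f).prod) +
      freeCumulant φ 2 ![f t, f s'] * (φ (C.map f).prod * φ ((P ++ s :: B ++ D).map f).prod) ≤
      φ ((P ++ s :: (B ++ t :: (C ++ s' :: D))).map f).prod := by
  classical
  have hA := le_sum_partCumulant_hasPair h1 hx (l := P ++ s :: (B ++ t :: (C ++ s' :: D))) rfl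
  have hB := le_sum_partCumulant_hasPair h1 hx (l := P ++ s :: (B ++ t :: (C ++ s' :: D)))
    (P := P ++ s :: B) (B := C) (D := D) (s := t) (t := s') (by simp)
  refine (add_le_add hA hB).trans ?_
  rw [← Finset.sum_union, moment_word_eq h1]
  · exact Finset.sum_le_sum_of_subset_of_nonneg
      (Finset.union_subset (Finset.filter_subset _ _) (Finset.filter_subset _ _)) fun π _ _ =>
        Finset.prod_nonneg fun V _ => hx _ V
  · rw [Finset.disjoint_left]
    intro π hπ hπ'
    have h2 := (Finset.mem_filter.mp hπ').2
    have e : (P ++ s :: B).length = P.length + B.length + 1 := by simp; omega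
    rw [e] at h2
    exact (Finset.mem_filter.mp hπ).2.not_hasPair (by omega) (by omega) h2

end Words

/-! ### Cumulants and moments of `R`-diagonal elements -/

section RDiagonal

variable {A : Type*} [Ring A] [StarRing A] [Algebra ℂ A] {φ : FaithfulTrace A}

theorem eq_iff_even_of_alternating {n : ℕ} {ε : Fin n → Bool}
    (h : ∀ k l : Fin n, (l : ℕ) = k + 1 → ε l ≠ ε k) (h0 : 0 < n) (k : Fin n) :
    ε k = ε ⟨0, h0⟩ ↔ Even (k : ℕ) := by
  obtain ⟨k, hk⟩ := k
  induction k with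
  | zero => simp
  | succ k ih =>
    have h1 := h ⟨k, by omega⟩ ⟨k + 1, hk⟩ rfl
    have h2 := ih (by omega)
    simp only [Nat.even_add_one] at *
    rw [← h2]
    cases hx : ε ⟨k + 1, hk⟩ <;> cases hy : ε ⟨k, Nat.lt_of_succ_lt hk⟩ <;>
      cases hz : ε ⟨0, h0⟩ <;> simp_all

/-- `a*` counts `1` and `a` counts `-1`. -/
def starSign (ε : Bool) : ℤ := if ε then 1 else -1

theorem sum_starSign_of_alternating {n : ℕ} {ε : Fin n → Bool} (hn : Even n)
    (h : ∀ k l : Fin n, (l : ℕ) = k + 1 → ε l ≠ ε k) : ∑ k, starSign (ε k) = 0 := by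
  rcases Nat.eq_zero_or_pos n with rfl | h0
  · simp
  · have key : ∀ k : Fin n, starSign (ε k) = starSign (ε ⟨0, h0⟩) * (-1) ^ (k : ℕ) := by
      intro k
      have := eq_iff_even_of_alternating h h0 k
      rcases Nat.even_or_odd (k : ℕ) with he | ho
      · rw [this.mpr he, he.neg_one_pow, mul_one]
      · have hne : ε k ≠ ε ⟨0, h0⟩ := fun e => Nat.not_even_iff_odd.mpr ho (this.mp e)
        rw [ho.neg_one_pow]
        cases hx : ε k <;> cases hy : ε ⟨0, h0⟩ <;> simp_all [starSign]
    rw [Finset.sum_congr rfl fun k _ => key k, ← Finset.mul_sum,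
      Fin.sum_univ_eq_sum_range (fun k => (-1 : ℤ) ^ k), neg_one_geom_sum, if_pos hn, mul_zero]

theorem sum_block_eq {β : Type*} [AddCommMonoid β] {n : ℕ} (V : Finset (Fin n)) (g : Fin n → β) :
    ∑ k ∈ V, g k = ∑ i : Fin V.card, g (V.orderEmbOfFin rfl i) := by
  conv_lhs => rw [← Finset.map_orderEmbOfFin_univ V rfl]
  rw [Finset.sum_map]
  rfl

/-- A word with a non-zero moment in a `*`-free family of `R`-diagonal elements contains as many
adjoints of generators as generators, since so does every block with a non-zero cumulant. -/
theorem sum_starSign_eq_zero {ι : Type*} {a : ι → A} (hfree : StarFree φ a)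
    (hR : ∀ i, IsRDiagonal φ (a i)) {l : List (ι × Bool)}
    (hl : φ.toLinear (l.map fun s => starPow (a s.1) s.2).prod ≠ 0) :
    (l.map fun s => starSign s.2).sum = 0 := by
  rw [moment_word_eq φ.map_one' (fun s : ι × Bool => starPow (a s.1) s.2) l] at hl
  obtain ⟨π, _, hπ⟩ := Finset.exists_ne_zero_of_sum_ne_zero hl
  rw [partCumulant, Finset.prod_ne_zero_iff] at hπ
  rw [← ofFn_map_getElem, List.sum_ofFn, ← π.biUnion_parts, Finset.sum_biUnion π.disjoint]
  refine Finset.sum_eq_zero fun V hV => ?_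
  rw [id, sum_block_eq]
  have hne := hπ V hV
  set s : Fin V.card → ι × Bool := fun i => l[(V.orderEmbOfFin rfl i : ℕ)] with hs
  have hne' : freeCumulant φ V.card (fun k => starPow (a (s k).1) (s k).2) ≠ 0 := hne
  have hsame : ∀ k m, (s k).1 = (s m).1 := by
    by_contra hcon
    push Not at hcon
    exact hne' (hfree _ (fun k => (s k).1) (fun k => (s k).2) hcon)
  obtain ⟨v, hv⟩ := π.nonempty_of_mem_parts hV
  have h0 : 0 < V.card := Finset.card_pos.mpr ⟨v, hv⟩
  have hne2 : freeCumulant φ V.card (fun k => starPow (a (s ⟨0, h0⟩).1) (s k).2) ≠ 0 := by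
    convert hne' using 3 with k
    rw [hsame k ⟨0, h0⟩]
  obtain ⟨he, halt⟩ := hR _ _ _ hne2
  exact sum_starSign_of_alternating he halt

variable {a : A}

theorem IsRDiagonal.freeCumulant_nonneg (hR : IsRDiagonal φ a) (hN : HasNonnegCumulants φ a)
    (n : ℕ) (ε : Fin n → Bool) : 0 ≤ freeCumulant φ n (fun k => starPow a (ε k)) := by
  by_cases h : freeCumulant φ n (fun k => starPow a (ε k)) = 0
  · rw [h]
  · obtain ⟨he, halt⟩ := hR n ε h
    rcases Nat.eq_zero_or_pos n with rfl | h0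
    · convert (hN 0).1
    · obtain ⟨m, hm⟩ := he
      have hm' : n = 2 * m := by omega
      subst hm'
      have key := eq_iff_even_of_alternating halt h0
      cases hε : ε ⟨0, h0⟩
      · convert (hN m).1 using 3 with k
        have := key k
        rw [hε] at this
        by_cases hk : Even (k : ℕ)
        · rw [this.mpr hk, if_pos hk]; rfl
        · rw [if_neg hk, Bool.eq_true_of_not_eq_false fun e => hk (this.mp e)]; rfl
      · convert (hN m).2 using 3 with k
        have := key k
        rw [hε] at this
        by_cases hk : Even (k : ℕ)
        · rw [this.mpr hk, if_pos hk]; rfl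
        · rw [if_neg hk, Bool.eq_false_of_not_eq_true fun e => hk (this.mp e)]; rfl

theorem IsRDiagonal.blockCumulant_nonneg (hR : IsRDiagonal φ a) (hN : HasNonnegCumulants φ a)
    (l : List Bool) (V : Finset (Fin l.length)) :
    0 ≤ blockCumulant φ (letters (starPow a) l) V :=
  hR.freeCumulant_nonneg hN V.card fun i => l[(V.orderEmbOfFin rfl i : ℕ)]

/-- The first cumulants vanish, so the second cumulants are the second moments. -/
theorem IsRDiagonal.freeCumulant_two (hR : IsRDiagonal φ a) (ε δ : Bool) :
    freeCumulant φ 2 ![starPow a ε, starPow a δ] = φ.toLinear (starPow a ε * starPow a δ) := by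
  rw [freeCumulant_eq, Finset.sum_eq_zero, sub_zero]
  · simp
  · intro π hπ
    obtain ⟨V, ⟨hV, h0⟩, _⟩ := π.existsUnique_mem (Finset.mem_univ 0)
    refine Finset.prod_eq_zero hV ?_
    by_contra hne
    have e : (![starPow a ε, starPow a δ] : Fin 2 → A) = fun k => starPow a (![ε, δ] k) := by
      funext k
      fin_cases k <;> rfl
    rw [e] at hne
    have h1 := (hR V.card (fun i => ![ε, δ] (V.orderEmbOfFin rfl i)) hne).1
    have h2 := card_lt_of_mem_properNC hπ hV
    have h3 : 0 < V.card := Finset.card_pos.mpr ⟨_, h0⟩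
    have h4 : V.card = 1 := by omega
    rw [h4] at h1
    exact absurd h1 (by decide)

end RDiagonal

/-! ### The rainbow pairing -/

section Rainbow

variable {n N : ℕ} {π : Finpartition (Finset.univ : Finset (Fin N))}

/-- A non-crossing pairing of the first `n` points with the last `n` points is the rainbow. -/
theorem rainbow_of_isNonCrossing (hN : N = n + n) (hπ : IsNonCrossing π)
    (h : ∀ V ∈ π.parts, ∃ i j : Fin N, V = {i, j} ∧ (i : ℕ) < n ∧ n ≤ (j : ℕ)) (m : ℕ) :
    ∀ i j : Fin N, (i : ℕ) = m → {i, j} ∈ π.parts → (i : ℕ) < n → n ≤ (j : ℕ) →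
      (i : ℕ) + j + 1 = N := by
  have huniq : ∀ V ∈ π.parts, ∀ W ∈ π.parts, ∀ x ∈ V, x ∈ W → V = W := by
    intro V hV W hW x hx hx'
    by_contra hne
    exact Finset.disjoint_left.mp (π.disjoint hV hW hne) hx hx'
  induction m using Nat.strong_induction_on with
  | _ m ih =>
    intro i j him hij hi hj
    rcases lt_trichotomy ((i : ℕ) + j + 1) N with hlt | heq | hgt
    · -- the mirror image of `i` lies beyond `j`, and has no possible partner
      have hk : N - 1 - i < N := by omega
      obtain ⟨V, ⟨hV, hkV⟩, _⟩ := π.existsUnique_mem (Finset.mem_univ (⟨N - 1 - i, hk⟩ : Fin N))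
      obtain ⟨i', j', rfl, hi', hj'⟩ := h V hV
      have hj'k : j' = ⟨N - 1 - i, hk⟩ := by
        simp only [Finset.mem_insert, Finset.mem_singleton] at hkV
        rcases hkV with e | e
        · have := congrArg Fin.val e
          simp only at this
          omega
        · exact e.symm
      have hj'v : (j' : ℕ) = N - 1 - i := congrArg Fin.val hj'k
      rcases lt_trichotomy (i' : ℕ) i with h1 | h1 | h1
      · have := ih i' (by omega) i' j' rfl hV hi' hj'
        omega
      · have e : i' = i := Fin.ext h1
        have := huniq _ hV _ hij i (by simp [e]) (by simp)
        have hj'' : j' ∈ ({i, j} : Finset (Fin N)) := this ▸ by simp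
        simp only [Finset.mem_insert, Finset.mem_singleton] at hj''
        rcases hj'' with e | e <;> have := congrArg Fin.val e <;> omega
      · have := hπ _ hij _ hV i (by simp) i' (by simp) j (by simp) j' (by simp)
          (by omega) (by omega) (by omega)
        have hj'' : j' ∈ ({i, j} : Finset (Fin N)) := this ▸ by simp
        simp only [Finset.mem_insert, Finset.mem_singleton] at hj''
        rcases hj'' with e | e <;> have := congrArg Fin.val e <;> omega
    · exact heq
    · -- the mirror image of `j` lies before `i`, and is already paired with `j`
      have hk : N - 1 - j < N := by omega
      obtain ⟨V, ⟨hV, hkV⟩, _⟩ := π.existsUnique_mem (Finset.mem_univ (⟨N - 1 - j, hk⟩ : Fin N))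
      obtain ⟨i', j', rfl, hi', hj'⟩ := h V hV
      have hi'k : i' = ⟨N - 1 - j, hk⟩ := by
        simp only [Finset.mem_insert, Finset.mem_singleton] at hkV
        rcases hkV with e | e
        · exact e.symm
        · have := congrArg Fin.val e
          simp only at this
          omega
      have hi'v : (i' : ℕ) = N - 1 - j := congrArg Fin.val hi'k
      have := ih i' (by omega) i' j' rfl hV hi' hj'
      have e : j' = j := Fin.ext (by omega)
      have := huniq _ hV _ hij j (by simp [e]) (by simp)
      have hi'' : i' ∈ ({i, j} : Finset (Fin N)) := this ▸ by simp
      simp only [Finset.mem_insert, Finset.mem_singleton] at hi''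
      rcases hi'' with e | e <;> have := congrArg Fin.val e <;> omega

/-- There is at most one non-crossing pairing of the first `n` points with the last `n` points. -/
theorem eq_of_rainbow (hN : N = n + n) {ρ : Finpartition (Finset.univ : Finset (Fin N))}
    (hπ : IsNonCrossing π) (hρ : IsNonCrossing ρ)
    (h : ∀ V ∈ π.parts, ∃ i j : Fin N, V = {i, j} ∧ (i : ℕ) < n ∧ n ≤ (j : ℕ))
    (h' : ∀ V ∈ ρ.parts, ∃ i j : Fin N, V = {i, j} ∧ (i : ℕ) < n ∧ n ≤ (j : ℕ)) : π = ρ := by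
  have key : ∀ {π ρ : Finpartition (Finset.univ : Finset (Fin N))},
      IsNonCrossing π → IsNonCrossing ρ →
      (∀ V ∈ π.parts, ∃ i j : Fin N, V = {i, j} ∧ (i : ℕ) < n ∧ n ≤ (j : ℕ)) →
      (∀ V ∈ ρ.parts, ∃ i j : Fin N, V = {i, j} ∧ (i : ℕ) < n ∧ n ≤ (j : ℕ)) →
      ∀ V ∈ π.parts, V ∈ ρ.parts := by
    intro π ρ hπ hρ h h' V hV
    obtain ⟨i, j, rfl, hi, hj⟩ := h V hV
    obtain ⟨W, ⟨hW, hiW⟩, _⟩ := ρ.existsUnique_mem (Finset.mem_univ i)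
    obtain ⟨i', j', rfl, hi', hj'⟩ := h' W hW
    have e1 := rainbow_of_isNonCrossing hN hπ h i i j rfl hV hi hj
    have e2 := rainbow_of_isNonCrossing hN hρ h' i' i' j' rfl hW hi' hj'
    have e3 : i = i' := by
      simp only [Finset.mem_insert, Finset.mem_singleton] at hiW
      rcases hiW with e | e
      · exact e
      · have := congrArg Fin.val e
        omega
    have e4 : j = j' := Fin.ext (by rw [e3] at e1; omega)
    rw [e3, e4]
    exact hW
  exact Finpartition.ext (Finset.ext fun V => ⟨key hπ hρ h h' V, key hρ hπ h' h V⟩)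

end Rainbow

section RainbowMoment

variable {A : Type*} [Ring A] [StarRing A] [Algebra ℂ A] {φ : FaithfulTrace A} {a : A}

/-- The letters of a block with a non-zero cumulant alternate, while those of `a*ⁿ aⁿ` change only
once; so the block has two elements, one in each half. -/
theorem IsRDiagonal.block_of_ne_zero (hR : IsRDiagonal φ a) {n : ℕ}
    {V : Finset (Fin (List.replicate n true ++ List.replicate n false).length)}
    (hne : V.Nonempty) (hV : blockCumulant φ (letters (starPow a) _) V ≠ 0) :
    ∃ i j, V = {i, j} ∧ (i : ℕ) < n ∧ n ≤ (j : ℕ) := by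
  have hlet : ∀ k : Fin (List.replicate n true ++ List.replicate n false).length,
      (List.replicate n true ++ List.replicate n false)[(k : ℕ)] = true ↔ (k : ℕ) < n := by
    intro k
    rw [List.getElem_append]
    split_ifs with h <;> simpa using h
  obtain ⟨he, halt⟩ := hR V.card
    (fun i => (List.replicate n true ++ List.replicate n false)[(V.orderEmbOfFin rfl i : ℕ)]) hV
  have hstep : ∀ k l : Fin V.card, (l : ℕ) = k + 1 →
      ((V.orderEmbOfFin rfl k : ℕ) < n ∧ n ≤ (V.orderEmbOfFin rfl l : ℕ)) := by
    intro k l hkl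
    have h1 := halt k l hkl
    have h2 := hlet (V.orderEmbOfFin rfl k)
    have h3 := hlet (V.orderEmbOfFin rfl l)
    have h4 : V.orderEmbOfFin rfl k < V.orderEmbOfFin rfl l :=
      (V.orderEmbOfFin rfl).strictMono (by omega)
    rw [Fin.lt_def] at h4
    by_contra hcon
    apply h1
    rw [Bool.eq_iff_iff, h2, h3]
    omega
  have hpos := Finset.card_pos.mpr hne
  have hcard : V.card = 2 := by
    obtain ⟨m, hm⟩ := he
    by_contra hcon
    have h1 := hstep ⟨0, by omega⟩ ⟨1, by omega⟩ rfl
    have h2 := hstep ⟨1, by omega⟩ ⟨2, by omega⟩ rfl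
    omega
  obtain ⟨h1, h2⟩ := hstep ⟨0, by omega⟩ ⟨1, by omega⟩ rfl
  refine ⟨_, _, (Finset.eq_of_subset_of_card_le ?_ ?_).symm, h1, h2⟩
  · intro x hx
    simp only [Finset.mem_insert, Finset.mem_singleton] at hx
    rcases hx with rfl | rfl <;> exact Finset.orderEmbOfFin_mem _ _ _
  · rw [Finset.card_pair fun e => by rw [e] at h1; omega]
    exact hcard.le

/-- `φ (a*ⁿ aⁿ)` is `φ (a* a)ⁿ` or `0`: only the rainbow pairing can contribute. -/
theorem IsRDiagonal.moment_rainbow (hR : IsRDiagonal φ a) (n : ℕ) :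
    φ.toLinear (star a ^ n * a ^ n) = 0 ∨
      φ.toLinear (star a ^ n * a ^ n) = φ.toLinear (star a * a) ^ n := by
  have hm := moment_word_eq φ.map_one' (starPow a) (List.replicate n true ++ List.replicate n false)
  have hw : ((List.replicate n true ++ List.replicate n false).map (starPow a)).prod =
      star a ^ n * a ^ n := by
    simp [starPow]
  rw [hw] at hm
  have hblock : ∀ π : Finpartition (Finset.univ :
      Finset (Fin (List.replicate n true ++ List.replicate n false).length)),
      partCumulant φ (letters (starPow a) _) π ≠ 0 →
      ∀ V ∈ π.parts, ∃ i j, V = {i, j} ∧ (i : ℕ) < n ∧ n ≤ (j : ℕ) := by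
    intro π hπ V hV
    rw [partCumulant, Finset.prod_ne_zero_iff] at hπ
    exact hR.block_of_ne_zero (π.nonempty_of_mem_parts hV) (hπ V hV)
  by_cases hex : ∃ π ∈ allNC (List.replicate n true ++ List.replicate n false).length,
      partCumulant φ (letters (starPow a) _) π ≠ 0
  · right
    obtain ⟨π, hπ, hne⟩ := hex
    rw [hm, Finset.sum_eq_single π]
    · have hval : ∀ V ∈ π.parts, blockCumulant φ (letters (starPow a)
          (List.replicate n true ++ List.replicate n false)) V = φ.toLinear (star a * a) := by
        intro V hV
        obtain ⟨i, j, rfl, hi, hj⟩ := hblock π hne V hV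
        have hi' : letters (starPow a) (List.replicate n true ++ List.replicate n false) i =
            starPow a true := by
          rw [letters, List.getElem_append_left (by simpa using hi)]; simp
        have hj' : letters (starPow a) (List.replicate n true ++ List.replicate n false) j =
            starPow a false := by
          rw [letters, List.getElem_append_right (by simpa using hj)]; simp
        rw [blockCumulant_pair _ _ (by rw [Fin.lt_def]; omega), hi', hj', hR.freeCumulant_two]
        rfl
      rw [partCumulant, Finset.prod_congr rfl hval, Finset.prod_const]
      have hc := π.sum_card_parts
      rw [Finset.sum_congr rfl (g := fun _ => 2)] at hc
      · simp only [Finset.sum_const, smul_eq_mul, Finset.card_univ, Fintype.card_fin,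
          List.length_append, List.length_replicate] at hc
        congr 1
        omega
      · intro V hV
        obtain ⟨i, j, rfl, hi, hj⟩ := hblock π hne V hV
        exact Finset.card_pair (by rintro rfl; omega)
    · intro ρ hρ hρπ
      by_contra hne'
      exact hρπ (eq_of_rainbow (by simp) (mem_allNC.mp hρ) (mem_allNC.mp hπ) (hblock ρ hne')
        (hblock π hne))
    · exact fun h => absurd hπ h
  · left
    push Not at hex
    rw [hm]
    exact Finset.sum_eq_zero hex

end RainbowMoment

/-! ### Counting non-crossing pairings -/

section Counting

/-- Lower bounds for a function of words in the letters `true` and `false` (standing for `a*` and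
`a`) that hold when it counts, with non-negative weights, structures containing all non-crossing
pairings of equally many `true`s and `false`s. -/
structure PairingBound (M : List Bool → ℝ) : Prop where
  nonneg : ∀ w, 0 ≤ M w
  nil : M [] = 1
  chord : ∀ (P B D : List Bool) (s : Bool), M B * M (P ++ D) ≤ M (P ++ (!s) :: (B ++ s :: D))
  two_chords : ∀ (P B C D : List Bool) (s : Bool),
    M B * M (P ++ (C ++ (!s) :: D)) + M C * M (P ++ (!s) :: B ++ D) ≤
      M (P ++ (!s) :: (B ++ s :: (C ++ (!s) :: D)))

/-- The word `a*^m aⁿ w`. -/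
def block (m n : ℕ) (w : List Bool) : List Bool :=
  List.replicate m true ++ (List.replicate n false ++ w)

variable {M : List Bool → ℝ} (hM : PairingBound M)

namespace PairingBound

include hM

theorem le_cancel (P D : List Bool) (k : ℕ) : M (P ++ D) ≤ M (P ++ block k k D) := by
  induction k generalizing P D with
  | zero => simp [block]
  | succ k ih =>
    have h1 := hM.chord (P ++ List.replicate k true) [] (List.replicate k false ++ D) false
    rw [hM.nil, one_mul] at h1
    have h2 := ih P D
    refine h2.trans (le_of_eq_of_le ?_ (h1.trans_eq ?_))
    · simp [block]
    · rw [block, List.replicate_succ' (n := k) (a := true), List.replicate_succ]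
      simp

theorem one_le_rainbow (k : ℕ) : 1 ≤ M (block k k []) := by
  simpa [hM.nil] using hM.le_cancel [] [] k

/-- The non-crossing pairings of `a*^n₁ a^n₂ a*^n₃ a^n₄ w` that pair all of the second and third
blocks with letters of the first four blocks are classified by the number `y` of pairs between the
second and the third block. -/
theorem sum_le_four_blocks (w : List Bool) (n₂ : ℕ) : ∀ (n₁ n₃ n₄ K : ℕ),
    ∑ y ∈ Finset.range K, (if y ≤ n₂ ∧ y ≤ n₃ ∧ n₂ ≤ n₁ + y ∧ n₃ ≤ n₄ + y then
      M (block (n₁ + y - n₂) (n₄ + y - n₃) w) else 0) ≤ M (block n₁ n₂ (block n₃ n₄ w)) := by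
  -- removing the third block together with its partners in the fourth
  have hthird : ∀ (P : List Bool) (n₃ n₄ : ℕ), n₃ ≤ n₄ →
      M (P ++ (List.replicate (n₄ - n₃) false ++ w)) ≤ M (P ++ block n₃ n₄ w) := by
    intro P n₃ n₄ h
    obtain ⟨d, rfl⟩ := Nat.exists_eq_add_of_le h
    rw [Nat.add_sub_cancel_left]
    refine (hM.le_cancel P (List.replicate d false ++ w) n₃).trans_eq ?_
    simp only [block, List.replicate_add, List.append_assoc]
  induction n₂ with
  | zero =>
    intro n₁ n₃ n₄ K
    cases K with
    | zero => simpa using hM.nonneg _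
    | succ K =>
      rw [Finset.sum_range_succ', Finset.sum_eq_zero, zero_add]
      · split_ifs with h
        · have := hthird (List.replicate n₁ true) n₃ n₄ (by omega)
          simpa [block] using this
        · exact hM.nonneg _
      · intro y _
        rw [if_neg (by omega)]
  | succ n₂ ih =>
    intro n₁ n₃ n₄ K
    cases K with
    | zero => simpa using hM.nonneg _
    | succ K =>
      rw [Finset.sum_range_succ']
      cases n₃ with
      | zero =>
        rw [Finset.sum_eq_zero, zero_add]
        · split_ifs with h
          · obtain ⟨d, hd⟩ := Nat.exists_eq_add_of_le h.2.2.1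
            have := hM.le_cancel (List.replicate d true) (List.replicate n₄ false ++ w) (n₂ + 1)
            have e : n₁ = d + (n₂ + 1) := by omega
            subst e
            refine le_of_eq_of_le ?_ (this.trans_eq ?_)
            · simp [block]
            · simp only [block, List.replicate_add d, List.replicate_zero, List.nil_append,
                List.append_assoc]
          · exact hM.nonneg _
        · intro y _
          rw [if_neg (by omega)]
      | succ n₃ =>
        have h1 : ∑ y ∈ Finset.range K, (if y + 1 ≤ n₂ + 1 ∧ y + 1 ≤ n₃ + 1 ∧
            n₂ + 1 ≤ n₁ + (y + 1) ∧ n₃ + 1 ≤ n₄ + (y + 1) then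
            M (block (n₁ + (y + 1) - (n₂ + 1)) (n₄ + (y + 1) - (n₃ + 1)) w) else 0) ≤
            M (block n₁ n₂ (block n₃ n₄ w)) := by
          refine (Finset.sum_congr rfl fun y _ => ?_).trans_le (ih n₁ n₃ n₄ K)
          refine if_congr (by omega) ?_ rfl
          rw [show n₁ + (y + 1) - (n₂ + 1) = n₁ + y - n₂ by omega,
            show n₄ + (y + 1) - (n₃ + 1) = n₄ + y - n₃ by omega]
        refine (add_le_add_left h1 _).trans ?_
        by_cases h : n₂ + 1 ≤ n₁
        · -- the last letter of the second block has two possible partners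
          obtain ⟨d, hd⟩ := Nat.exists_eq_add_of_le h
          have e : n₁ = d + (n₂ + 1) := by omega
          have h2 := hM.two_chords (List.replicate d true) (block n₂ n₂ []) []
            (block n₃ n₄ w) false
          rw [hM.nil, one_mul] at h2
          have h3 : M (List.replicate d true ++ block (n₃ + 1) n₄ w) ≤ M (block n₂ n₂ []) *
              M (List.replicate d true ++ ([] ++ (!false) :: block n₃ n₄ w)) := by
            have h4 := mul_le_mul_of_nonneg_right (hM.one_le_rainbow n₂)
              (hM.nonneg (List.replicate d true ++ block (n₃ + 1) n₄ w))
            rw [one_mul] at h4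
            refine h4.trans_eq ?_
            rw [block, block, List.replicate_succ]
            simp [block]
          have h5 : (if 0 ≤ n₂ + 1 ∧ 0 ≤ n₃ + 1 ∧ n₂ + 1 ≤ n₁ + 0 ∧ n₃ + 1 ≤ n₄ + 0 then
              M (block (n₁ + 0 - (n₂ + 1)) (n₄ + 0 - (n₃ + 1)) w) else 0) ≤
              M (List.replicate d true ++ block (n₃ + 1) n₄ w) := by
            split_ifs with h6
            · have := hthird (List.replicate d true) (n₃ + 1) n₄ (by omega)
              refine le_of_eq_of_le ?_ this
              rw [block, show n₁ + 0 - (n₂ + 1) = d by omega]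
              rfl
            · exact hM.nonneg _
          have h7 : block n₁ n₂ (block n₃ n₄ w) =
              List.replicate d true ++ (!false) :: block n₂ n₂ [] ++ block n₃ n₄ w := by
            rw [e, block, block, List.replicate_add d, List.replicate_succ]
            simp [block]
          have h8 : block n₁ (n₂ + 1) (block (n₃ + 1) n₄ w) =
              List.replicate d true ++ (!false) :: (block n₂ n₂ [] ++ false ::
                ([] ++ (!false) :: block n₃ n₄ w)) := by
            rw [e, block, block, List.replicate_add d, List.replicate_succ (a := true) (n := n₂),
              List.replicate_succ (a := true) (n := n₃), List.replicate_succ' (a := false)]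
            simp [block]
          rw [h7, h8]
          linarith
        · rw [if_neg (by omega), add_zero]
          have h2 := hM.chord (List.replicate n₁ true ++ List.replicate n₂ false) []
            (block n₃ n₄ w) true
          rw [hM.nil, one_mul] at h2
          refine le_of_eq_of_le ?_ (h2.trans_eq ?_)
          · simp [block]
          · simp only [block, List.replicate_succ (n := n₃), List.replicate_succ' (n := n₂)]
            simp

end PairingBound

/-- The sum of `q^{n₁ + ⋯ + n₂ᵣ} M (a*^n₁ a^n₂ ⋯ a*^n₂ᵣ₋₁ a^n₂ᵣ w)` over all exponents up to `N`. -/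
def blockSum (M : List Bool → ℝ) (q : ℝ) (N : ℕ) : ℕ → List Bool → ℝ
  | 0, w => M w
  | r + 1, w => ∑ m ∈ Finset.range (N + 1), ∑ n ∈ Finset.range (N + 1),
      q ^ (m + n) * blockSum M q N r (block m n w)

/-- The geometric sum `∑_{x ≤ N} q^{2x}`. -/
def geomSum (q : ℝ) (N : ℕ) : ℝ := ∑ x ∈ Finset.range (N + 1), q ^ (2 * x)

theorem geomSum_nonneg {q : ℝ} (hq : 0 ≤ q) (N : ℕ) : 0 ≤ geomSum q N :=
  Finset.sum_nonneg fun _ _ => by positivity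

theorem geomSum_mono {q : ℝ} (hq : 0 ≤ q) {N N' : ℕ} (h : N ≤ N') :
    geomSum q N ≤ geomSum q N' :=
  Finset.sum_le_sum_of_subset_of_nonneg (Finset.range_subset_range.mpr (by omega))
    fun _ _ _ => by positivity

namespace PairingBound

include hM

theorem blockSum_nonneg {q : ℝ} (hq : 0 ≤ q) (N r : ℕ) (w : List Bool) :
    0 ≤ blockSum M q N r w := by
  induction r generalizing w with
  | zero => exact hM.nonneg w
  | succ r ih =>
    exact Finset.sum_nonneg fun _ _ => Finset.sum_nonneg fun _ _ =>
      mul_nonneg (by positivity) (ih _)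

/-- Merging two of the pairs of blocks gains three free parameters: the numbers of pairs between
the first and second, the second and third, the third and fourth of the blocks involved. -/
theorem geomSum_mul_blockSum_one_le {q : ℝ} (hq : 0 ≤ q) (N : ℕ) (w : List Bool) :
    geomSum q N ^ 3 * blockSum M q N 1 w ≤ blockSum M q (2 * N) 2 w := by
  set R := Finset.range (N + 1) with hR
  set R' := Finset.range (2 * N + 1) with hR'
  let F : ℕ × ℕ × ℕ × ℕ × ℕ → ℝ := fun ⟨n₃, n₄, n₁, n₂, y⟩ => q ^ (n₃ + n₄) * (q ^ (n₁ + n₂) *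
    (if y ≤ n₂ ∧ y ≤ n₃ ∧ n₂ ≤ n₁ + y ∧ n₃ ≤ n₄ + y then
      M (block (n₁ + y - n₂) (n₄ + y - n₃) w) else 0))
  have hF : ∀ p, 0 ≤ F p := by
    rintro ⟨n₃, n₄, n₁, n₂, y⟩
    have : 0 ≤ if y ≤ n₂ ∧ y ≤ n₃ ∧ n₂ ≤ n₁ + y ∧ n₃ ≤ n₄ + y then
      M (block (n₁ + y - n₂) (n₄ + y - n₃) w) else 0 := by
      split_ifs
      · exact hM.nonneg _
      · exact le_rfl
    exact mul_nonneg (by positivity) (mul_nonneg (by positivity) this)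
  let e : ℕ × ℕ × ℕ × ℕ × ℕ → ℕ × ℕ × ℕ × ℕ × ℕ := fun ⟨x, y, z, m, n⟩ =>
    (y + z, z + n, x + m, x + y, y)
  have he : Function.Injective e := by
    rintro ⟨x, y, z, m, n⟩ ⟨x', y', z', m', n'⟩ h
    simp only [e, Prod.mk.injEq] at h ⊢
    omega
  have h1 : geomSum q N ^ 3 * blockSum M q N 1 w =
      ∑ p ∈ R ×ˢ R ×ˢ R ×ˢ R ×ˢ R, F (e p) := by
    have hFe : ∀ x y z m n, F (e (x, y, z, m, n)) =
        q ^ (2 * x) * (q ^ (2 * y) * (q ^ (2 * z) * (q ^ (m + n) * M (block m n w)))) := by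
      intro x y z m n
      simp only [F, e]
      rw [if_pos (by omega), show x + m + y - (x + y) = m by omega,
        show z + n + y - (y + z) = n by omega]
      ring
    simp only [Finset.sum_product, hFe, ← Finset.mul_sum, ← Finset.sum_mul]
    rw [← geomSum, blockSum]
    simp only [blockSum]
    ring
  have h2 : ∑ p ∈ R' ×ˢ R' ×ˢ R' ×ˢ R' ×ˢ R', F p ≤ blockSum M q (2 * N) 2 w := by
    simp only [blockSum, Finset.sum_product, F, ← Finset.mul_sum]
    gcongr
    exact hM.sum_le_four_blocks w _ _ _ _ _
  rw [h1]
  refine le_trans ?_ h2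
  rw [← Finset.sum_image (g := e) (f := F) he.injOn]
  refine Finset.sum_le_sum_of_subset_of_nonneg ?_ fun p _ _ => hF p
  intro p hp
  obtain ⟨⟨x, y, z, m, n⟩, hx, rfl⟩ := Finset.mem_image.mp hp
  simp only [R, R', e, Finset.mem_product, Finset.mem_range] at hx ⊢
  omega

theorem geomSum_mul_blockSum_le {q : ℝ} (hq : 0 ≤ q) (N r : ℕ) (w : List Bool) :
    geomSum q N ^ 3 * blockSum M q N (r + 1) w ≤ blockSum M q (2 * N) (r + 2) w := by
  induction r generalizing w with
  | zero => exact hM.geomSum_mul_blockSum_one_le hq N w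
  | succ r ih =>
    rw [blockSum, blockSum, Finset.mul_sum]
    have hsub : Finset.range (N + 1) ⊆ Finset.range (2 * N + 1) :=
      Finset.range_subset_range.mpr (by omega)
    have hpos : ∀ m n, 0 ≤ q ^ (m + n) * blockSum M q (2 * N) (r + 2) (block m n w) := fun m n =>
      mul_nonneg (by positivity) (hM.blockSum_nonneg hq _ _ _)
    refine le_trans (Finset.sum_le_sum fun m _ => ?_) (Finset.sum_le_sum_of_subset_of_nonneg hsub
      fun m _ _ => Finset.sum_nonneg fun n _ => hpos m n)
    rw [Finset.mul_sum]
    refine le_trans (Finset.sum_le_sum fun n _ => ?_) (Finset.sum_le_sum_of_subset_of_nonneg hsub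
      fun n _ _ => hpos m n)
    rw [mul_left_comm]
    exact mul_le_mul_of_nonneg_left (ih _) (by positivity)

/-- The weighted number of non-crossing pairings is at least a power of the geometric sum with
exponent `3r + 1`. This is the number of widths of bands of chords (`2r + 2` along sides, `r - 1`
along diagonals) in a quadrangulation of the polygon whose sides are the `2r + 2` blocks. -/
theorem geomSum_pow_le_blockSum {q : ℝ} (hq : 0 ≤ q) (N r : ℕ) :
    geomSum q N ^ (3 * r + 1) ≤ blockSum M q (2 ^ r * N) (r + 1) [] := by
  induction r with
  | zero =>
    simp only [pow_zero, one_mul, mul_zero, zero_add, pow_one, blockSum]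
    refine Finset.sum_le_sum fun m hm => ?_
    have h1 : q ^ (m + m) * M (block m m []) ≤
        ∑ n ∈ Finset.range (N + 1), q ^ (m + n) * M (block m n []) :=
      Finset.single_le_sum (f := fun n => q ^ (m + n) * M (block m n []))
        (fun n _ => mul_nonneg (by positivity) (hM.nonneg _)) hm
    refine le_trans ?_ h1
    rw [two_mul]
    exact le_mul_of_one_le_right (by positivity) (hM.one_le_rainbow m)
  | succ r ih =>
    have h1 := hM.geomSum_mul_blockSum_le hq (2 ^ r * N) r []
    have h2 : geomSum q N ≤ geomSum q (2 ^ r * N) :=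
      geomSum_mono hq (Nat.le_mul_of_pos_left N (by positivity))
    have h0 := geomSum_nonneg hq N
    calc geomSum q N ^ (3 * (r + 1) + 1) = geomSum q N ^ 3 * geomSum q N ^ (3 * r + 1) := by ring
      _ ≤ geomSum q (2 ^ r * N) ^ 3 * blockSum M q (2 ^ r * N) (r + 1) [] := by
          gcongr
          exact pow_nonneg (h0.trans h2) 3
      _ ≤ _ := by
          refine h1.trans_eq ?_
          rw [pow_succ' 2 r, mul_assoc]

end PairingBound

end Counting

/-! ### Adjoint and alternating words -/

section AlternatingWords

variable {β : Type*} (bar : β → β)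

/-- The adjoint of a word. -/
def adjWord (w : List β) : List β := (w.map bar).reverse

variable {bar}

theorem prod_adjWord {A : Type*} [Monoid A] [StarMul A] {f : β → A}
    (hf : ∀ l, f (bar l) = star (f l)) (w : List β) :
    ((adjWord bar w).map f).prod = star (w.map f).prod := by
  induction w with
  | nil => simp [adjWord]
  | cons l w ih =>
    rw [adjWord] at ih ⊢
    simp only [List.map_cons, List.reverse_cons, List.map_append, List.prod_append, ih,
      List.map_nil, List.prod_cons, List.prod_nil, mul_one, hf, star_mul]

theorem length_adjWord (w : List β) : (adjWord bar w).length = w.length := by simp [adjWord]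

theorem adjWord_append (v w : List β) :
    adjWord bar (v ++ w) = adjWord bar w ++ adjWord bar v := by simp [adjWord]

/-- In an alternating word every letter is the adjoint of its predecessor. -/
def IsAlternating (bar : β → β) (w : List β) : Prop := w.IsChain fun l m => m = bar l

theorem IsAlternating.append_adjWord (hbar : Function.Involutive bar) {w : List β}
    (hw : IsAlternating bar w) : IsAlternating bar (w ++ adjWord bar w) := by
  refine List.IsChain.append hw ?_ ?_
  · rw [adjWord, List.isChain_reverse, List.isChain_map]
    refine hw.imp fun l m h => ?_
    rw [h, hbar]
  · intro x hx y hy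
    simp only [adjWord, List.head?_reverse, List.getLast?_map, Option.mem_def] at hx hy
    rw [hx] at hy
    simpa using hy.symm

theorem IsAlternating.prod_eq {A : Type*} [Monoid A] {f : β → A}
    (hbar : Function.Involutive bar) (r : ℕ) :
    ∀ (l : β) (w : List β), IsAlternating bar (l :: w) → w.length = 2 * r + 1 →
      ((l :: w).map f).prod = (f l * f (bar l)) ^ (r + 1) := by
  induction r with
  | zero =>
    intro l w h hw
    obtain ⟨m, rfl⟩ := List.length_eq_one_iff.mp hw
    have : m = bar l := by simpa [IsAlternating] using h
    simp [this]
  | succ r ih =>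
    intro l w h hw
    match w, hw with
    | m :: n :: w, hw =>
      rw [IsAlternating, List.isChain_cons_cons, List.isChain_cons_cons] at h
      obtain ⟨rfl, rfl, h⟩ := h
      have h1 := ih _ w h (by simp at hw; omega)
      rw [List.map_cons, List.map_cons, List.prod_cons, List.prod_cons, h1, hbar,
        pow_succ' _ (r + 1), mul_assoc]

end AlternatingWords

/-! ### Hölder's inequality for a trace -/

section Holder

/-- The powers of `x* x` are of the form `y* y`. -/
theorem exists_star_mul_self_eq_pow {A : Type*} [Monoid A] [StarMul A] (x : A) (r : ℕ) :
    ∃ y : A, (star x * x) ^ r = star y * y := by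
  have hs : ∀ m : ℕ, star ((star x * x) ^ m) = (star x * x) ^ m := fun m => by simp
  rcases Nat.even_or_odd' r with ⟨m, rfl | rfl⟩
  · exact ⟨(star x * x) ^ m, by rw [hs, two_mul, pow_add]⟩
  · refine ⟨x * (star x * x) ^ m, ?_⟩
    rw [star_mul, hs]
    calc (star x * x) ^ (2 * m + 1) = (star x * x) ^ m * ((star x * x) * (star x * x) ^ m) := by
          rw [← pow_succ', ← pow_add]; congr 1; omega
      _ = _ := by simp only [mul_assoc]

variable {A : Type*} [Ring A] [StarRing A] [Algebra ℂ A] {φ : FaithfulTrace A}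

theorem FaithfulTrace.star_mul_pow_nonneg (φ : FaithfulTrace A) (x : A) (r : ℕ) :
    0 ≤ φ.toLinear ((star x * x) ^ r) := by
  obtain ⟨y, hy⟩ := exists_star_mul_self_eq_pow x r
  rw [hy]
  exact φ.nonneg' y

theorem FaithfulTrace.mul_star_pow (φ : FaithfulTrace A) (x : A) (r : ℕ) :
    φ.toLinear ((x * star x) ^ r) = φ.toLinear ((star x * x) ^ r) := by
  cases r with
  | zero => simp
  | succ r => rw [pow_succ, ← mul_assoc, φ.tracial', ← mul_assoc, ← mul_pow_mul, pow_succ,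
      mul_assoc]

theorem FaithfulTrace.norm_star_mul_pow (φ : FaithfulTrace A) (x : A) (r : ℕ) :
    ‖φ.toLinear ((star x * x) ^ r)‖ = (φ.toLinear ((star x * x) ^ r)).re := by
  have h := φ.star_mul_pow_nonneg x r
  exact (Complex.ofReal_re _).symm.trans (congrArg Complex.re (Complex.norm_of_nonneg' h))

theorem pNorm_nonneg (p : ℕ) (x : A) : 0 ≤ pNorm φ p x :=
  Real.rpow_nonneg (Complex.nonneg_iff.mp (φ.star_mul_pow_nonneg x _)).1 _

theorem pNorm_pow {r : ℕ} (hr : 1 ≤ r) (x : A) :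
    pNorm φ (2 * r) x ^ (2 * r) = (φ.toLinear ((star x * x) ^ r)).re := by
  have h := (Complex.nonneg_iff.mp (φ.star_mul_pow_nonneg x r)).1
  rw [pNorm, Nat.mul_div_cancel_left r two_pos, one_div]
  exact Real.rpow_inv_natCast_pow h (by omega)

theorem trace_word_rotate (φ : FaithfulTrace A) {β : Type*} (f : β → A) (v w : List β) :
    φ.toLinear ((v ++ w).map f).prod = φ.toLinear ((w ++ v).map f).prod := by
  simp only [List.map_append, List.prod_append]
  exact φ.tracial' _ _

variable [StarModule ℂ A]

theorem norm_toPreL2_sq (x : A) : ‖toPreL2 φ x‖ ^ 2 = (φ.toLinear (star x * x)).re := by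
  rw [← inner_self_eq_norm_sq (𝕜 := ℂ)]
  rfl

theorem FaithfulTrace.cauchySchwarz (φ : FaithfulTrace A) (x y : A) :
    ‖φ.toLinear (x * y)‖ ^ 2 ≤ ‖φ.toLinear (x * star x)‖ * ‖φ.toLinear (star y * y)‖ := by
  have h := norm_inner_le_norm (𝕜 := ℂ) (toPreL2 φ (star x)) (toPreL2 φ y)
  have e : inner ℂ (toPreL2 φ (star x)) (toPreL2 φ y) = φ.toLinear (star (star x) * y) := rfl
  rw [e, star_star] at h
  calc ‖φ.toLinear (x * y)‖ ^ 2 ≤ (‖toPreL2 φ (star x)‖ * ‖toPreL2 φ y‖) ^ 2 := by gcongr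
    _ = (φ.toLinear (x * star x)).re * (φ.toLinear (star y * y)).re := by
        rw [mul_pow, norm_toPreL2_sq, norm_toPreL2_sq, star_star]
    _ ≤ _ := by
        have h1 := (Complex.nonneg_iff.mp (φ.nonneg' y)).1
        gcongr <;> exact Complex.re_le_norm _

/-- The chessboard estimate. Among the words of length `2r` take one of maximal moment with a long
alternating factor; reflecting it, the Cauchy-Schwarz inequality gives another word of maximal
moment, with an alternating factor of twice the length. -/
theorem chessboard {β : Type*} [Finite β] {bar : β → β} {f : β → A} (φ : FaithfulTrace A)
    (hbar : Function.Involutive bar)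
    (hf : ∀ l, f (bar l) = star (f l)) {r : ℕ} (hr : 1 ≤ r)
    (h : ∀ l, ‖φ.toLinear ((f l * f (bar l)) ^ r)‖ ≤ 1) {w : List β} (hw : w.length = 2 * r) :
    ‖φ.toLinear (w.map f).prod‖ ≤ 1 := by
  let N : List β → ℝ := fun w => ‖φ.toLinear (w.map f).prod‖
  let S : Set (List β) := {w | w.length = 2 * r}
  have hrot : ∀ v w, N (v ++ w) = N (w ++ v) := fun v w =>
    congrArg norm (trace_word_rotate φ f v w)
  obtain ⟨w₀, hw₀, hmax⟩ := Set.exists_max_image S N (List.finite_length_eq β (2 * r)) ⟨w, hw⟩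
  rcases (norm_nonneg _ : 0 ≤ N w₀).eq_or_lt with hzero | hpos
  · exact ((hmax w hw).trans_eq hzero.symm).trans zero_le_one
  -- the reflection of a maximal word is maximal
  have hrefl : ∀ B D, B.length = r → D.length = r → N (B ++ D) = N w₀ →
      N (B ++ adjWord bar B) = N w₀ := by
    intro B D hB hD hBD
    have hB' : B ++ adjWord bar B ∈ S := by
      simp only [S, Set.mem_ofPred_eq, List.length_append, length_adjWord]; omega
    have hD' : adjWord bar D ++ D ∈ S := by
      simp only [S, Set.mem_ofPred_eq, List.length_append, length_adjWord]; omega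
    refine le_antisymm (hmax _ hB') ?_
    have hcs : N (B ++ D) ^ 2 ≤ N (B ++ adjWord bar B) * N (adjWord bar D ++ D) := by
      simp only [N, List.map_append, List.prod_append, prod_adjWord hf]
      exact φ.cauchySchwarz _ _
    have h1 : N (B ++ adjWord bar B) * N (adjWord bar D ++ D) ≤
        N (B ++ adjWord bar B) * N w₀ :=
      mul_le_mul_of_nonneg_left (hmax _ hD') (norm_nonneg _)
    rw [hBD, sq] at hcs
    exact le_of_mul_le_mul_right (hcs.trans h1) hpos
  have key : ∀ k, 1 ≤ k → k ≤ r → ∃ T R, (T ++ R).length = 2 * r ∧ N (T ++ R) = N w₀ ∧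
      R.length = k ∧ IsAlternating bar R := by
    intro k hk
    induction k, hk using Nat.le_induction with
    | base =>
      intro _
      have hlen : (w₀.drop (2 * r - 1)).length = 1 := by
        rw [List.length_drop, hw₀]; omega
      refine ⟨w₀.take (2 * r - 1), w₀.drop (2 * r - 1), ?_, ?_, hlen, ?_⟩
      · rw [List.take_append_drop]; exact hw₀
      · rw [List.take_append_drop]
      · obtain ⟨m, hm⟩ := List.length_eq_one_iff.mp hlen
        rw [hm]
        exact List.isChain_singleton m
    | succ k hk ih =>
      intro hkr
      obtain ⟨T, R, hlen, hTR, hR, halt⟩ := ih (by omega)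
      rw [List.length_append] at hlen
      have h1 : N ((T.drop r ++ R) ++ T.take r) = N w₀ := by
        rw [hrot, ← List.append_assoc, List.take_append_drop, hTR]
      have h2 := hrefl (T.drop r ++ R) (T.take r)
        (by rw [List.length_append, List.length_drop]; omega)
        (by rw [List.length_take]; omega) h1
      rw [adjWord_append, ← List.append_assoc, hrot, List.append_assoc, ← List.append_assoc] at h2
      have halt2 := halt.append_adjWord hbar
      refine ⟨adjWord bar (T.drop r) ++ T.drop r ++ (R ++ adjWord bar R).take (k - 1),
        (R ++ adjWord bar R).drop (k - 1), ?_, ?_, ?_, halt2.drop _⟩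
      · rw [List.append_assoc, List.take_append_drop]
        simp only [List.length_append, length_adjWord, List.length_drop]
        omega
      · rw [List.append_assoc, List.take_append_drop]
        exact h2
      · rw [List.length_drop, List.length_append, length_adjWord]
        omega
  obtain ⟨T, R, hlen, hTR, hR, halt⟩ := key r hr le_rfl
  rw [List.length_append] at hlen
  rw [hrot] at hTR
  have h2 := hrefl R T hR (by omega) hTR
  have halt2 := halt.append_adjWord hbar
  refine (hmax w hw).trans ?_
  rw [← h2]
  match R, hR with
  | [], hR => simp at hR; omega
  | l :: R, hR =>
    obtain ⟨r, rfl⟩ : ∃ r', r = r' + 1 := ⟨r - 1, by omega⟩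
    have h3 := IsAlternating.prod_eq (f := f) hbar r l (R ++ adjWord bar (l :: R)) halt2 (by
      simp only [List.length_append, length_adjWord, List.length_cons] at *; omega)
    simp only [N, List.cons_append, h3]
    exact h l

/-- The Hölder inequality for the pair `|s|^{p-2} s* x` with `p = 2r`. -/
theorem norm_trace_pow_mul_le {r : ℕ} (hr : 1 ≤ r) (s x : A) (hs : 0 < pNorm φ (2 * r) s) :
    ‖φ.toLinear ((star s * s) ^ (r - 1) * (star s * x))‖ ≤
      pNorm φ (2 * r) s ^ (2 * r - 1) * pNorm φ (2 * r) x := by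
  have key : ∀ τ > pNorm φ (2 * r) x, ‖φ.toLinear ((star s * s) ^ (r - 1) * (star s * x))‖ ≤
      pNorm φ (2 * r) s ^ (2 * r - 1) * τ := by
    intro τ hτ
    set σ := pNorm φ (2 * r) s with hσ
    have hτ0 : 0 < τ := (pNorm_nonneg _ x).trans_lt hτ
    let z : Bool → A := fun b => if b then ((σ⁻¹ : ℝ) : ℂ) • s else ((τ⁻¹ : ℝ) : ℂ) • x
    have hscale : ∀ (c : ℝ) (y : A), 0 < c → pNorm φ (2 * r) y ≤ c →
        ‖φ.toLinear ((star (((c⁻¹ : ℝ) : ℂ) • y) * (((c⁻¹ : ℝ) : ℂ) • y)) ^ r)‖ ≤ 1 := by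
      intro c y hc hy
      have e : (star (((c⁻¹ : ℝ) : ℂ) • y) * (((c⁻¹ : ℝ) : ℂ) • y)) ^ r =
          (((c⁻¹ ^ (2 * r) : ℝ)) : ℂ) • (star y * y) ^ r := by
        rw [star_smul, smul_mul_smul_comm, smul_pow]
        congr 1
        rw [Complex.star_def, Complex.conj_ofReal, pow_mul]
        push_cast
        ring
      rw [e, map_smul, norm_smul, φ.norm_star_mul_pow, ← pNorm_pow hr, Complex.norm_real,
        Real.norm_of_nonneg (by positivity), inv_pow, inv_mul_le_one₀ (by positivity)]
      exact pow_le_pow_left₀ (pNorm_nonneg _ _) hy _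
    have hz : ∀ b, ‖φ.toLinear ((star (z b) * z b) ^ r)‖ ≤ 1 := by
      intro b
      cases b
      · exact hscale τ x hτ0 hτ.le
      · exact hscale σ s hs le_rfl
    let bar : Bool × Bool → Bool × Bool := fun l => (l.1, !l.2)
    let f : Bool × Bool → A := fun l => starPow (z l.1) l.2
    have hf : ∀ l, f (bar l) = star (f l) := by
      rintro ⟨b, e⟩
      cases e <;> simp [f, bar, starPow]
    have h := chessboard (bar := bar) (f := f) φ (fun l => by simp [bar]) hf hr (by
      rintro ⟨b, e⟩
      rw [hf]
      cases e
      · simp only [f, starPow, Bool.false_eq_true, if_false]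
        rw [φ.mul_star_pow]
        exact hz b
      · simp only [f, starPow, if_true, star_star]
        exact hz b)
      (w := (List.replicate (r - 1) [(true, true), (true, false)]).flatten ++
        [(true, true), (false, false)]) (by simp; omega)
    have hprod : (((List.replicate (r - 1) [(true, true), (true, false)]).flatten ++
        [(true, true), (false, false)]).map f).prod =
        (((σ⁻¹ ^ (2 * r - 1) * τ⁻¹ : ℝ)) : ℂ) • ((star s * s) ^ (r - 1) * (star s * x)) := by
      simp only [List.map_append, List.prod_append, List.map_flatten, List.map_replicate,
        List.prod_flatten, List.map_cons, List.map_nil, List.prod_cons, List.prod_nil, mul_one,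
        List.prod_replicate, f, z, starPow, if_true, Bool.false_eq_true, if_false]
      rw [star_smul, smul_mul_smul_comm, smul_mul_smul_comm, smul_pow, smul_mul_smul_comm]
      congr 1
      rw [Complex.star_def, Complex.conj_ofReal, show 2 * r - 1 = 2 * (r - 1) + 1 by omega,
        pow_succ, pow_mul]
      push_cast
      ring
    rw [hprod, map_smul, norm_smul, Complex.norm_real, Real.norm_of_nonneg (by positivity),
      inv_pow, ← mul_inv, inv_mul_le_one₀ (by positivity)] at h
    exact h
  have hpos : 0 < pNorm φ (2 * r) s ^ (2 * r - 1) := by positivity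
  rw [← div_le_iff₀' hpos]
  refine le_of_forall_gt_imp_ge_of_dense fun τ hτ => ?_
  rw [div_le_iff₀' hpos]
  exact key τ hτ

end Holder

/-! ### The `L^p`-norm of the resolvent -/

section Moments

variable {A : Type*} [Ring A] [StarRing A] [Algebra ℂ A] [StarModule ℂ A]

theorem inner_toL2 (φ : FaithfulTrace A) (x y : A) :
    inner ℂ (toL2 φ x) (toL2 φ y) = φ.toLinear (star x * y) :=
  UniformSpace.Completion.inner_coe (𝕜 := ℂ) (toPreL2 φ x) (toPreL2 φ y)

theorem norm_toL2_sq (φ : FaithfulTrace A) (x : A) :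
    ‖toL2 φ x‖ ^ 2 = (φ.toLinear (star x * x)).re := by
  rw [← inner_self_eq_norm_sq (𝕜 := ℂ), inner_toL2]
  rfl

theorem trace_star_mul_self (φ : FaithfulTrace A) (x : A) :
    φ.toLinear (star x * x) = ((‖toL2 φ x‖ ^ 2 : ℝ) : ℂ) := by
  rw [norm_toL2_sq]
  exact Complex.ext rfl (Complex.nonneg_iff.mp (φ.nonneg' x)).2.symm

theorem norm_toL2_pos (φ : FaithfulTrace A) {x : A} (hx : x ≠ 0) : 0 < ‖toL2 φ x‖ := by
  refine (norm_nonneg _).lt_of_ne fun h => hx (φ.faithful' x ?_)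
  have := trace_star_mul_self φ x
  rw [← h] at this
  simpa using this

/-- The multiple of `a` whose `L²`-norm is `1`. -/
noncomputable def normalize (φ : FaithfulTrace A) (a : A) : A := ((‖toL2 φ a‖⁻¹ : ℝ) : ℂ) • a

/-- The real part of the moment of a word in the normalization of `a` and its adjoint. -/
noncomputable def wordMoment (φ : FaithfulTrace A) (a : A) (w : List Bool) : ℝ :=
  (φ.toLinear (w.map (starPow (normalize φ a))).prod).re

variable {φ : FaithfulTrace A} {a : A}

theorem map_starPow_smul_prod (c : ℝ) (w : List Bool) :
    (w.map (starPow ((c : ℂ) • a))).prod = ((c ^ w.length : ℝ) : ℂ) • (w.map (starPow a)).prod := by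
  induction w with
  | nil => simp
  | cons ε w ih =>
    have h : starPow ((c : ℂ) • a) ε = (c : ℂ) • starPow a ε := by
      cases ε <;> simp [starPow]
    rw [List.map_cons, List.prod_cons, ih, h, smul_mul_smul_comm, List.map_cons, List.prod_cons,
      List.length_cons, pow_succ', Complex.ofReal_mul]

theorem wordMoment_eq (w : List Bool) : wordMoment φ a w =
    ‖toL2 φ a‖⁻¹ ^ w.length * (φ.toLinear (w.map (starPow a)).prod).re := by
  rw [wordMoment, normalize, map_starPow_smul_prod, map_smul, smul_eq_mul, Complex.re_ofReal_mul]

/-- The moments of a normalized `R`-diagonal element with non-negative cumulants dominate the number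
of non-crossing `*`-pairings, i.e. the moments of a circular element. -/
theorem pairingBound_wordMoment (hR : IsRDiagonal φ a) (hN : HasNonnegCumulants φ a) (ha : a ≠ 0) :
    PairingBound (wordMoment φ a) := by
  have hx := fun l V => hR.blockCumulant_nonneg hN l V
  have hK := norm_toL2_pos φ ha
  set K := ‖toL2 φ a‖ with hKdef
  have h0 : ∀ w : List Bool, 0 ≤ φ.toLinear (w.map (starPow a)).prod := fun w =>
    moment_word_nonneg φ.map_one' hx w
  have hmul : ∀ v w : List Bool, (((K ^ 2 : ℝ) : ℂ) * (φ.toLinear (v.map (starPow a)).prod *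
      φ.toLinear (w.map (starPow a)).prod)).re = K ^ 2 * ((φ.toLinear (v.map (starPow a)).prod).re *
      (φ.toLinear (w.map (starPow a)).prod).re) := by
    intro v w
    rw [Complex.re_ofReal_mul, Complex.mul_re, ← (Complex.nonneg_iff.mp (h0 v)).2, zero_mul,
      sub_zero]
  have hκ : ∀ s : Bool, φ.toLinear (starPow a (!s) * starPow a s) = ((K ^ 2 : ℝ) : ℂ) := by
    intro s
    cases s
    · exact trace_star_mul_self φ a
    · exact (φ.tracial' _ _).trans (trace_star_mul_self φ a)
  have hκ' : ∀ s : Bool, φ.toLinear (starPow a s * starPow a (!s)) = ((K ^ 2 : ℝ) : ℂ) := fun s =>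
    (φ.tracial' _ _).trans (hκ s)
  have hcan : K⁻¹ ^ 2 * K ^ 2 = 1 := by
    rw [← mul_pow, inv_mul_cancel₀ hK.ne', one_pow]
  refine ⟨fun w => ?_, ?_, fun P B D s => ?_, fun P B C D s => ?_⟩
  · rw [wordMoment_eq]
    exact mul_nonneg (by positivity) (Complex.nonneg_iff.mp (h0 w)).1
  · rw [wordMoment_eq]
    simp [φ.map_one']
  · have h := moment_chord_le φ.map_one' hx P B D (!s) s
    rw [hR.freeCumulant_two, hκ] at h
    have h1 := (Complex.le_def.mp h).1
    rw [hmul] at h1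
    have h' := mul_le_mul_of_nonneg_left h1
      (by positivity : 0 ≤ K⁻¹ ^ (P ++ (!s) :: (B ++ s :: D)).length)
    rw [wordMoment_eq, wordMoment_eq, wordMoment_eq]
    refine le_of_eq_of_le ?_ h'
    simp only [List.length_append, List.length_cons, ← hKdef]
    linear_combination (-(K⁻¹ ^ (P.length + B.length + D.length)) *
      (φ.toLinear (B.map (starPow a)).prod).re *
      (φ.toLinear ((P ++ D).map (starPow a)).prod).re) * hcan
  · have h := moment_two_chords_le φ.map_one' hx P B C D (!s) s (!s)
    rw [hR.freeCumulant_two, hR.freeCumulant_two, hκ, hκ'] at h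
    have h1 := (Complex.le_def.mp h).1
    rw [Complex.add_re, hmul, hmul] at h1
    have h' := mul_le_mul_of_nonneg_left h1
      (by positivity : 0 ≤ K⁻¹ ^ (P ++ (!s) :: (B ++ s :: (C ++ (!s) :: D))).length)
    simp only [wordMoment_eq]
    refine le_of_eq_of_le ?_ h'
    simp only [List.length_append, List.length_cons, ← hKdef]
    linear_combination (-(K⁻¹ ^ (P.length + B.length + C.length + D.length + 1)) *
      ((φ.toLinear (B.map (starPow a)).prod).re *
      (φ.toLinear ((P ++ (C ++ (!s) :: D)).map (starPow a)).prod).re +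
      (φ.toLinear (C.map (starPow a)).prod).re *
      (φ.toLinear ((P ++ (!s) :: B ++ D).map (starPow a)).prod).re)) * hcan

/-- The truncated resolvent `∑_{n ≤ N} qⁿ bⁿ`. -/
noncomputable def truncResolvent (q : ℝ) (N : ℕ) (b : A) : A :=
  ∑ n ∈ Finset.range (N + 1), ((q ^ n : ℝ) : ℂ) • b ^ n

theorem star_truncResolvent_mul (q : ℝ) (N : ℕ) (b W : A) :
    star (truncResolvent q N b) * (truncResolvent q N b * W) =
      ∑ m ∈ Finset.range (N + 1), ∑ n ∈ Finset.range (N + 1),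
        ((q ^ (m + n) : ℝ) : ℂ) • (star b ^ m * (b ^ n * W)) := by
  rw [truncResolvent, star_sum, Finset.sum_mul]
  refine Finset.sum_congr rfl fun m _ => ?_
  rw [Finset.sum_mul, Finset.mul_sum]
  refine Finset.sum_congr rfl fun n _ => ?_
  rw [star_smul, star_pow, smul_mul_assoc (_ : ℂ) (b ^ n), smul_mul_smul_comm, Complex.star_def,
    Complex.conj_ofReal, ← Complex.ofReal_mul, pow_add]

theorem map_block_prod {A : Type*} [Ring A] [StarRing A] (b : A) (m n : ℕ) (w : List Bool) :
    ((block m n w).map (starPow b)).prod = star b ^ m * (b ^ n * (w.map (starPow b)).prod) := by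
  simp [block, starPow]

theorem re_trace_truncResolvent (q : ℝ) (N r : ℕ) (w : List Bool) :
    (φ.toLinear ((star (truncResolvent q N (normalize φ a)) *
      truncResolvent q N (normalize φ a)) ^ r * (w.map (starPow (normalize φ a))).prod)).re =
      blockSum (wordMoment φ a) q N r w := by
  induction r generalizing w with
  | zero => simp [blockSum, wordMoment]
  | succ r ih =>
    rw [pow_succ, mul_assoc, mul_assoc, star_truncResolvent_mul, blockSum, Finset.mul_sum, map_sum,
      Complex.re_sum]
    refine Finset.sum_congr rfl fun m _ => ?_
    rw [Finset.mul_sum, map_sum, Complex.re_sum]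
    refine Finset.sum_congr rfl fun n _ => ?_
    rw [mul_smul_comm, map_smul, smul_eq_mul, Complex.re_ofReal_mul, ← map_block_prod, ih]

theorem re_trace_truncResolvent_mul_pow_nonneg (hM : PairingBound (wordMoment φ a)) {q : ℝ}
    (hq : 0 ≤ q) (N r n : ℕ) :
    0 ≤ (φ.toLinear ((star (truncResolvent q N (normalize φ a)) *
      truncResolvent q N (normalize φ a)) ^ r *
      (star (truncResolvent q N (normalize φ a)) * normalize φ a ^ n))).re := by
  have e : star (truncResolvent q N (normalize φ a)) * normalize φ a ^ n =
      ∑ m ∈ Finset.range (N + 1), ((q ^ m : ℝ) : ℂ) •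
        ((block m n []).map (starPow (normalize φ a))).prod := by
    conv_lhs => rw [truncResolvent, star_sum, Finset.sum_mul]
    refine Finset.sum_congr rfl fun m _ => ?_
    rw [star_smul, star_pow, smul_mul_assoc, Complex.star_def, Complex.conj_ofReal, map_block_prod]
    simp
  rw [e, Finset.mul_sum, map_sum, Complex.re_sum]
  refine Finset.sum_nonneg fun m _ => ?_
  rw [mul_smul_comm, map_smul, smul_eq_mul, Complex.re_ofReal_mul, re_trace_truncResolvent]
  exact mul_nonneg (by positivity) (hM.blockSum_nonneg hq _ _ _)

/-- Since all moments are non-negative, pairing the resolvent with `s (s* s)^{r-1}`, where `s` is a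
truncation of the resolvent, gives at least `φ ((s* s)^r)`; by Hölder's inequality and continuity of
the inner product the `L^p`-norm of the resolvent is at least that of `s`. -/
theorem pNorm_truncResolvent_le_lpNorm (hM : PairingBound (wordMoment φ a)) {q : ℝ} (hq : 0 ≤ q)
    {r : ℕ} (hr : 1 ≤ r) (N : ℕ)
    (hs : 0 < pNorm φ (2 * r) (truncResolvent q N (normalize φ a))) {ξ : L2 φ}
    (hξ : HasSum (fun n : ℕ => ((q ^ n : ℝ) : ℂ) • toL2 φ (normalize φ a ^ n)) ξ) {β : ℝ}
    (hβ : 0 ≤ β) (S : Set A) :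
    ENNReal.ofReal (β * pNorm φ (2 * r) (truncResolvent q N (normalize φ a))) ≤
      lpNorm φ S (2 * r) ((β : ℂ) • ξ) := by
  set b := normalize φ a with hb
  set s := truncResolvent q N b with hs'
  set P := pNorm φ (2 * r) s with hP
  set Y := s * (star s * s) ^ (r - 1) with hY
  have hYx : ∀ x, inner ℂ (toL2 φ Y) (toL2 φ x) =
      φ.toLinear ((star s * s) ^ (r - 1) * (star s * x)) := by
    intro x
    rw [inner_toL2, hY, star_mul, star_pow, star_mul, star_star, mul_assoc]
  have hpow : P ^ (2 * r - 1) * P = (φ.toLinear ((star s * s) ^ r)).re := by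
    rw [← pow_succ, show 2 * r - 1 + 1 = 2 * r by omega, hP, pNorm_pow hr]
  have hsum : HasSum (fun n : ℕ => q ^ n *
      (φ.toLinear ((star s * s) ^ (r - 1) * (star s * b ^ n))).re)
      (inner ℂ (toL2 φ Y) ξ).re := by
    have h1 := Complex.hasSum_re ((innerSL ℂ (toL2 φ Y)).hasSum hξ)
    simpa only [innerSL_apply_apply, inner_smul_right, hYx, Complex.re_ofReal_mul] using h1
  have hlow : P ^ (2 * r - 1) * P ≤ (inner ℂ (toL2 φ Y) ξ).re := by
    refine le_trans (le_of_eq ?_) (sum_le_hasSum (Finset.range (N + 1)) (fun n _ =>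
      mul_nonneg (by positivity) (re_trace_truncResolvent_mul_pow_nonneg hM hq N _ n)) hsum)
    have e : (star s * s) ^ r = (star s * s) ^ (r - 1) * (star s * s) := by
      rw [← pow_succ, Nat.sub_add_cancel hr]
    rw [hpow, e]
    conv_lhs => enter [1, 2, 2, 2]; rw [hs', truncResolvent]
    rw [Finset.mul_sum, Finset.mul_sum, map_sum, Complex.re_sum]
    refine Finset.sum_congr rfl fun n _ => ?_
    rw [mul_smul_comm, mul_smul_comm, map_smul, smul_eq_mul, Complex.re_ofReal_mul]
  refine le_sInf ?_
  rintro L ⟨x, -, -, hx, hL⟩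
  have hc : 0 < P ^ (2 * r - 1) := by positivity
  have hlim1 : Tendsto (fun n => ENNReal.ofReal ‖inner ℂ (toL2 φ Y) (toL2 φ (x n))‖) atTop
      (𝓝 (ENNReal.ofReal ‖inner ℂ (toL2 φ Y) ((β : ℂ) • ξ)‖)) :=
    ENNReal.tendsto_ofReal (((innerSL ℂ (toL2 φ Y)).continuous.tendsto _).comp hx).norm
  have hlim2 := ENNReal.Tendsto.const_mul (a := ENNReal.ofReal (P ^ (2 * r - 1))) hL
    (Or.inr ENNReal.ofReal_ne_top)
  have hle := le_of_tendsto_of_tendsto' hlim1 hlim2 fun n => by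
    rw [← ENNReal.ofReal_mul hc.le, hYx]
    exact ENNReal.ofReal_le_ofReal (norm_trace_pow_mul_le hr s (x n) hs)
  rw [← ENNReal.mul_le_mul_iff_right (a := ENNReal.ofReal (P ^ (2 * r - 1)))
    (ENNReal.ofReal_pos.mpr hc).ne' ENNReal.ofReal_ne_top]
  refine le_trans ?_ hle
  rw [← ENNReal.ofReal_mul hc.le]
  refine ENNReal.ofReal_le_ofReal ?_
  rw [inner_smul_right, norm_mul, Complex.norm_real, Real.norm_of_nonneg hβ, mul_left_comm]
  exact mul_le_mul_of_nonneg_left (hlow.trans (Complex.re_le_norm _)) hβ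

/-- The `L^p`-norm of a sufficiently long truncation of the resolvent is bounded below by the
weighted number of non-crossing pairings. -/
theorem geomSum_pow_le_pNorm_pow (hM : PairingBound (wordMoment φ a)) {q : ℝ} (hq : 0 ≤ q)
    (N r : ℕ) : geomSum q N ^ (3 * r + 1) ≤
      pNorm φ (2 * (r + 1)) (truncResolvent q (2 ^ r * N) (normalize φ a)) ^ (2 * (r + 1)) := by
  rw [pNorm_pow (by omega)]
  have h := re_trace_truncResolvent (φ := φ) (a := a) q (2 ^ r * N) (r + 1) []
  rw [List.map_nil, List.prod_nil, mul_one] at h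
  rw [h]
  exact hM.geomSum_pow_le_blockSum hq N r

end Moments

/-! ### The dilation operator -/

section Dilation

variable {A : Type*} [Ring A] [StarRing A] [Algebra ℂ A] [StarModule ℂ A] {φ : FaithfulTrace A}
  {ι : Type*} {a : ι → A}

/-- Words of different lengths are orthogonal. -/
theorem inner_word_eq_zero (hfree : StarFree φ a) (hR : ∀ i, IsRDiagonal φ (a i)) {v w : List ι}
    (h : v.length ≠ w.length) :
    inner ℂ (toL2 φ (v.map a).prod) (toL2 φ (w.map a).prod) = 0 := by
  rw [inner_toL2]
  by_contra hne
  have hstar : ∀ v : List ι, star (v.map a).prod =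
      ((v.reverse.map fun i => (i, true)).map fun s : ι × Bool => starPow (a s.1) s.2).prod := by
    intro v
    induction v with
    | nil => simp
    | cons i v ih => simp [ih, starPow]
  have hword : (w.map a).prod =
      ((w.map fun i => (i, false)).map fun s : ι × Bool => starPow (a s.1) s.2).prod := by
    simp [starPow, Function.comp_def]
  rw [hstar, hword, ← List.prod_append, ← List.map_append] at hne
  have h0 := sum_starSign_eq_zero hfree hR hne
  rw [List.map_append, List.map_map, List.map_map, List.sum_append] at h0
  simp only [starSign, Function.comp_def, if_true, Bool.false_eq_true, if_false, List.map_const',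
    List.sum_replicate, List.length_reverse, nsmul_eq_mul, mul_one] at h0
  omega

/-- The closed subspace of `L²` generated by the words of length `n`. -/
noncomputable def homogeneous (φ : FaithfulTrace A) (a : ι → A) (n : ℕ) : Submodule ℂ (L2 φ) :=
  (Submodule.span ℂ {ξ | ∃ w : List ι, w.length = n ∧ toL2 φ (w.map a).prod = ξ}).topologicalClosure

noncomputable instance (n : ℕ) : (homogeneous φ a n).HasOrthogonalProjection :=
  haveI : CompleteSpace (homogeneous φ a n) :=
    (Submodule.isClosed_topologicalClosure _).completeSpace_coe
  inferInstance

theorem homogeneous_le (n : ℕ) : homogeneous φ a n ≤ L2hol φ (Set.range a) := by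
  refine Submodule.topologicalClosure_minimal _ (Submodule.span_le.mpr ?_)
    (Submodule.isClosed_topologicalClosure _)
  rintro _ ⟨w, -, rfl⟩
  exact (word φ a w).2

theorem starProjection_homogeneous_word (hfree : StarFree φ a) (hR : ∀ i, IsRDiagonal φ (a i))
    (n : ℕ) (w : List ι) : (homogeneous φ a n).starProjection (toL2 φ (w.map a).prod) =
      if n = w.length then toL2 φ (w.map a).prod else 0 := by
  split_ifs with h
  · rw [Submodule.starProjection_eq_self_iff]
    exact Submodule.le_topologicalClosure _ (Submodule.subset_span ⟨w, h.symm, rfl⟩)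
  · rw [Submodule.starProjection_apply_eq_zero_iff, homogeneous, Submodule.orthogonal_closure,
      Submodule.mem_orthogonal]
    intro u hu
    induction hu using Submodule.span_induction with
    | mem u hu =>
      obtain ⟨v, hv, rfl⟩ := hu
      exact inner_word_eq_zero hfree hR (hv ▸ h)
    | zero => exact inner_zero_left _
    | add u v _ _ hu hv => rw [inner_add_left, hu, hv, add_zero]
    | smul c u _ hu => rw [inner_smul_left, hu, mul_zero]

/-- The words span a dense subspace of `L²_hol`. -/
theorem dense_span_word : Dense (Submodule.span ℂ (Set.range (word φ a)) : Set
    (L2hol φ (Set.range a))) := by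
  rw [Subtype.dense_iff]
  refine closure_mono ?_
  have h : (Subalgebra.toSubmodule (Algebra.adjoin ℂ (Set.range a))).map (toL2 φ) ≤
      (Submodule.span ℂ (Set.range (word φ a))).map (L2hol φ (Set.range a)).subtype := by
    rw [Algebra.adjoin_eq_span, Submodule.map_span, Submodule.map_span]
    refine Submodule.span_mono ?_
    rintro _ ⟨x, hx, rfl⟩
    obtain ⟨l, hl, rfl⟩ := Submonoid.exists_list_of_mem_closure hx
    have hl' : l ∈ Set.range (List.map a) := by
      rw [Set.range_list_map]
      exact hl
    obtain ⟨w, rfl⟩ := hl'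
    exact ⟨word φ a w, ⟨w, rfl⟩, rfl⟩
  exact h

theorem hasSum_clm_apply {E : Type*} [NormedAddCommGroup E] [NormedSpace ℂ E] {F : ℕ → E →L[ℂ] E}
    {T : E →L[ℂ] E} (h : HasSum F T) (x : E) : HasSum (fun n => F n x) (T x) :=
  (ContinuousLinearMap.apply ℂ E x).hasSum h

/-- The operator `∑ e^{-nt} P_n` on `L²`, with `P_n` the projection onto the homogeneous subspace of
degree `n`. -/
theorem exists_dilation_L2 (hfree : StarFree φ a) (hR : ∀ i, IsRDiagonal φ (a i)) {t : ℝ}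
    (ht : 0 < t) : ∃ T : L2 φ →L[ℂ] L2 φ,
      (∀ w : List ι, T (toL2 φ (w.map a).prod) =
        ((Real.exp (-(w.length : ℝ) * t) : ℝ) : ℂ) • toL2 φ (w.map a).prod) ∧
      ∀ ξ, T ξ ∈ L2hol φ (Set.range a) := by
  have hgeo : Summable fun n : ℕ => Real.exp (-(n : ℝ) * t) := by
    have := Real.summable_exp_nat_mul_iff.mpr (neg_lt_zero.mpr ht)
    simpa using this
  have hF : Summable fun n : ℕ =>
      ((Real.exp (-(n : ℝ) * t) : ℝ) : ℂ) • (homogeneous φ a n).starProjection := by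
    refine Summable.of_norm_bounded hgeo fun n => ?_
    rw [norm_smul, Complex.norm_real, Real.norm_of_nonneg (Real.exp_nonneg _)]
    exact mul_le_of_le_one_right (Real.exp_nonneg _) (Submodule.starProjection_norm_le _)
  obtain ⟨T, hT⟩ := hF
  have hTξ : ∀ ξ, HasSum (fun n : ℕ => ((Real.exp (-(n : ℝ) * t) : ℝ) : ℂ) •
      (homogeneous φ a n).starProjection ξ) (T ξ) := fun ξ =>
    hasSum_clm_apply hT ξ
  refine ⟨T, fun w => ?_, fun ξ => ?_⟩
  · refine (hTξ _).unique ?_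
    convert hasSum_single w.length fun n hn => ?_ using 1
    · rw [starProjection_homogeneous_word hfree hR, if_pos rfl]
    · rw [starProjection_homogeneous_word hfree hR, if_neg hn, smul_zero]
  · rw [← (hTξ ξ).tsum_eq]
    exact tsum_mem (Submodule.isClosed_topologicalClosure _) fun n =>
      Submodule.smul_mem _ _ (homogeneous_le n (Submodule.starProjection_apply_mem _ _))

theorem existsUnique_isDilation (hfree : StarFree φ a) (hR : ∀ i, IsRDiagonal φ (a i)) {t : ℝ}
    (ht : 0 < t) : ∃! D, IsDilation φ a t D := by
  obtain ⟨T, hT, hmem⟩ := exists_dilation_L2 hfree hR ht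
  refine ⟨(T ∘L (L2hol φ (Set.range a)).subtypeL).codRestrict _ fun ξ => hmem ξ,
    fun w => Subtype.ext (hT w), fun D hD => ?_⟩
  refine ContinuousLinearMap.ext_on dense_span_word ?_
  rintro _ ⟨w, rfl⟩
  rw [hD w]
  exact Subtype.ext (hT w).symm

end Dilation

/-! ### The resolvent of the normalized generator -/

section Resolvent

variable {A : Type*} [Ring A] [StarRing A] [Algebra ℂ A] [StarModule ℂ A] {φ : FaithfulTrace A}
  {ι : Type*} {a : ι → A}

theorem normalize_pow (φ : FaithfulTrace A) (a : A) (n : ℕ) :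
    normalize φ a ^ n = ((‖toL2 φ a‖⁻¹ ^ n : ℝ) : ℂ) • a ^ n := by
  rw [normalize, smul_pow, Complex.ofReal_pow]

theorem IsRDiagonal.norm_toL2_normalize_pow_le {a : A} (hR : IsRDiagonal φ a) (n : ℕ) :
    ‖toL2 φ (normalize φ a ^ n)‖ ≤ 1 := by
  rw [normalize_pow, map_smul, norm_smul, Complex.norm_real, Real.norm_of_nonneg (by positivity)]
  have h : ‖toL2 φ (a ^ n)‖ ≤ ‖toL2 φ a‖ ^ n := by
    refine le_of_sq_le_sq ?_ (by positivity)
    rw [norm_toL2_sq, star_pow]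
    rcases hR.moment_rainbow n with h | h
    · rw [h, Complex.zero_re]
      positivity
    · rw [h, trace_star_mul_self, ← Complex.ofReal_pow, Complex.ofReal_re, ← pow_mul, ← pow_mul,
        mul_comm 2 n]
  refine (mul_le_mul_of_nonneg_left h (by positivity)).trans ?_
  rw [← mul_pow]
  exact pow_le_one₀ (by positivity) inv_mul_le_one

theorem inner_normalize_pow_eq_zero (hfree : StarFree φ a) (hR : ∀ i, IsRDiagonal φ (a i)) (i : ι)
    {m n : ℕ} (h : m ≠ n) :
    inner ℂ (toL2 φ (normalize φ (a i) ^ m)) (toL2 φ (normalize φ (a i) ^ n)) = 0 := by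
  have h0 := inner_word_eq_zero hfree hR (v := List.replicate m i) (w := List.replicate n i)
    (by simpa using h)
  simp only [List.map_replicate, List.prod_replicate] at h0
  rw [normalize_pow, normalize_pow, map_smul, map_smul, inner_smul_left, inner_smul_right, h0,
    mul_zero, mul_zero]

/-- Pythagoras for an orthogonal series of vectors of norm at most `1`. -/
theorem norm_sq_le_of_hasSum_orthogonal {E : Type*} [NormedAddCommGroup E] [InnerProductSpace ℂ E]
    {e : ℕ → E} (horth : ∀ m n, m ≠ n → inner ℂ (e m) (e n) = 0) (he : ∀ n, ‖e n‖ ≤ 1)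
    {c : ℕ → ℝ} {ψ : E} (hψ : HasSum (fun n => (c n : ℂ) • e n) ψ) {C : ℝ}
    (hc : HasSum (fun n => c n ^ 2) C) : ‖ψ‖ ^ 2 ≤ C := by
  have hcoef : ∀ n, inner ℂ (e n) ψ = ((c n * ‖e n‖ ^ 2 : ℝ) : ℂ) := by
    intro n
    refine ((innerSL ℂ (e n)).hasSum hψ).unique ?_
    convert hasSum_single n fun m hm => ?_ using 1
    · rw [innerSL_apply_apply, inner_smul_right, inner_self_eq_norm_sq_to_K]
      push_cast
      rfl
    · rw [innerSL_apply_apply, inner_smul_right, horth n m hm.symm, mul_zero]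
  have h1 : HasSum (fun n => c n ^ 2 * ‖e n‖ ^ 2) (‖ψ‖ ^ 2) := by
    have h := Complex.hasSum_re ((innerSL ℂ ψ).hasSum hψ)
    have e2 : (innerSL ℂ ψ ψ).re = ‖ψ‖ ^ 2 := by
      rw [innerSL_apply_apply]
      exact inner_self_eq_norm_sq (𝕜 := ℂ) ψ
    rw [e2] at h
    convert h using 2 with n
    rw [innerSL_apply_apply, inner_smul_right, ← inner_conj_symm, hcoef, Complex.conj_ofReal,
      ← Complex.ofReal_mul, Complex.ofReal_re]
    ring
  refine hasSum_le (fun n => ?_) h1 hc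
  exact mul_le_of_le_one_right (by positivity) (pow_le_one₀ (norm_nonneg _) (he n))

/-- The resolvent `∑ e^{-nt} bⁿ` of the normalization `b` of a member of the family. -/
theorem exists_resolvent (hfree : StarFree φ a) (hR : ∀ i, IsRDiagonal φ (a i)) (i : ι) {t : ℝ}
    (ht : 0 < t) : ∃ ψ : L2hol φ (Set.range a),
      HasSum (fun n : ℕ => ((Real.exp (-(n : ℝ) * t) : ℝ) : ℂ) • toL2 φ (normalize φ (a i) ^ n))
        (ψ : L2 φ) ∧
      (ψ : L2 φ) ∈ L2hol φ {a i} ∧ ψ ≠ 0 ∧ ‖ψ‖ ^ 2 ≤ (1 - Real.exp (-2 * t))⁻¹ ∧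
      ∀ D, IsDilation φ a t D →
        HasSum (fun n : ℕ => ((Real.exp (-2 * t) ^ n : ℝ) : ℂ) • toL2 φ (normalize φ (a i) ^ n))
          (D ψ : L2 φ) := by
  let E := L2hol φ (Set.range a)
  have hcomplete : CompleteSpace E := (Submodule.isClosed_topologicalClosure _).completeSpace_coe
  have hgeo : Summable fun n : ℕ => Real.exp (-(n : ℝ) * t) := by
    have := Real.summable_exp_nat_mul_iff.mpr (neg_lt_zero.mpr ht)
    simpa using this
  let e : ℕ → E := fun n =>
    ((‖toL2 φ (a i)‖⁻¹ ^ n : ℝ) : ℂ) • word φ a (List.replicate n i)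
  have hword : ∀ n, ((word φ a (List.replicate n i) : E) : L2 φ) = toL2 φ (a i ^ n) := by
    intro n
    change toL2 φ ((List.replicate n i).map a).prod = _
    rw [List.map_replicate, List.prod_replicate]
  have hecoe : ∀ n, (e n : L2 φ) = toL2 φ (normalize φ (a i) ^ n) := by
    intro n
    rw [normalize_pow, map_smul, ← hword]
    rfl
  have he : ∀ n, ‖e n‖ ≤ 1 := fun n => by
    rw [← Submodule.norm_coe, hecoe]
    exact (hR i).norm_toL2_normalize_pow_le n
  have hsum : Summable fun n : ℕ => ((Real.exp (-(n : ℝ) * t) : ℝ) : ℂ) • e n := by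
    refine Summable.of_norm_bounded hgeo fun n => ?_
    rw [norm_smul, Complex.norm_real, Real.norm_of_nonneg (Real.exp_nonneg _)]
    exact mul_le_of_le_one_right (Real.exp_nonneg _) (he n)
  obtain ⟨ψ, hψ⟩ := hsum
  have hψ' : HasSum (fun n : ℕ => ((Real.exp (-(n : ℝ) * t) : ℝ) : ℂ) •
      toL2 φ (normalize φ (a i) ^ n)) (ψ : L2 φ) := by
    have h := E.subtypeL.hasSum hψ
    simpa only [map_smul, Submodule.subtypeL_apply, hecoe] using h
  have horth : ∀ m n, m ≠ n → inner ℂ (toL2 φ (normalize φ (a i) ^ m))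
      (toL2 φ (normalize φ (a i) ^ n)) = 0 := fun m n h =>
    inner_normalize_pow_eq_zero hfree hR i h
  refine ⟨ψ, hψ', ?_, ?_, ?_, ?_⟩
  · rw [← hψ'.tsum_eq]
    refine tsum_mem (Submodule.isClosed_topologicalClosure _) fun n => Submodule.smul_mem _ _ ?_
    refine Submodule.le_topologicalClosure _ (Submodule.mem_map_of_mem ?_)
    exact Subalgebra.pow_mem _
      (Subalgebra.smul_mem _ (Algebra.subset_adjoin (Set.mem_singleton _)) _) n
  · -- the constant term of `ψ` is `1`
    rintro rfl
    have h1 : inner ℂ (toL2 φ (normalize φ (a i) ^ 0)) ((0 : E) : L2 φ) = (1 : ℂ) := by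
      refine ((innerSL ℂ (toL2 φ (normalize φ (a i) ^ 0))).hasSum hψ').unique ?_
      convert hasSum_single 0 fun m hm => ?_ using 1
      · rw [innerSL_apply_apply, inner_smul_right, inner_toL2]
        simp [φ.map_one']
      · rw [innerSL_apply_apply, inner_smul_right, horth 0 m hm.symm, mul_zero]
    rw [Submodule.coe_zero, inner_zero_right] at h1
    exact zero_ne_one h1
  · rw [← Submodule.norm_coe]
    refine norm_sq_le_of_hasSum_orthogonal horth
      (fun n => (hR i).norm_toL2_normalize_pow_le n) hψ' ?_
    have h2 : Real.exp (-2 * t) < 1 := by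
      rw [Real.exp_lt_one_iff]
      linarith
    convert hasSum_geometric_of_lt_one (Real.exp_nonneg (-2 * t)) h2 using 2 with n
    rw [← Real.exp_nat_mul, ← Real.exp_nat_mul]
    congr 1
    push_cast
    ring
  · intro D hD
    have hDe : ∀ n, D (e n) = ((Real.exp (-(n : ℝ) * t) : ℝ) : ℂ) • e n := by
      intro n
      rw [map_smul, hD, List.length_replicate, smul_comm]
    have h := E.subtypeL.hasSum (D.hasSum hψ)
    simp only [map_smul, hDe, Submodule.subtypeL_apply, hecoe, smul_smul] at h
    convert h using 3 with n
    rw [← Complex.ofReal_mul, ← Real.exp_add, ← Real.exp_nat_mul]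
    congr 2
    ring

end Resolvent

/-! ### Numerical estimates -/

section Estimates

/-- The geometric sum up to `1/(4t)` is of order `1/t`. -/
theorem le_geomSum_exp {t : ℝ} (ht : 0 < t) :
    Real.exp (-1) / (4 * t) ≤ geomSum (Real.exp (-2 * t)) ⌊1 / (4 * t)⌋₊ := by
  have h1 : ∀ x ∈ Finset.range (⌊1 / (4 * t)⌋₊ + 1),
      Real.exp (-1) ≤ Real.exp (-2 * t) ^ (2 * x) := by
    intro x hx
    have hx' : (x : ℝ) ≤ 1 / (4 * t) := by
      refine le_trans ?_ (Nat.floor_le (by positivity))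
      exact_mod_cast Nat.lt_succ_iff.mp (Finset.mem_range.mp hx)
    rw [← Real.exp_nat_mul, Real.exp_le_exp]
    rw [le_div_iff₀ (by positivity)] at hx'
    push_cast
    linarith
  have h2 := Finset.card_nsmul_le_sum _ _ _ h1
  rw [Finset.card_range, nsmul_eq_mul] at h2
  refine le_trans ?_ h2
  have h3 := (Nat.lt_floor_add_one (1 / (4 * t))).le
  push_cast
  calc Real.exp (-1) / (4 * t) = (1 / (4 * t)) * Real.exp (-1) := by ring
    _ ≤ _ := by gcongr

theorem inv_one_sub_exp_le {t : ℝ} (ht : 0 < t) (ht1 : t < 1) :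
    (1 - Real.exp (-2 * t))⁻¹ ≤ 3 / (2 * t) := by
  have h1 : Real.exp (-2 * t) ≤ (1 + 2 * t)⁻¹ := by
    rw [neg_mul, Real.exp_neg]
    have := Real.add_one_le_exp (2 * t)
    exact inv_anti₀ (by positivity) (by linarith)
  have h2 : (1 + 2 * t)⁻¹ ≤ 1 - 2 * t / 3 := by
    rw [inv_le_iff_one_le_mul₀ (by positivity)]
    nlinarith
  have h3 : 2 * t / 3 ≤ 1 - Real.exp (-2 * t) := by linarith
  calc (1 - Real.exp (-2 * t))⁻¹ ≤ (2 * t / 3)⁻¹ := inv_anti₀ (by positivity) h3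
    _ = 3 / (2 * t) := by rw [inv_div]

/-- The constant of the lower bound for `p = 2 (r + 1)`. -/
noncomputable def lowerConst (r : ℕ) : ℝ :=
  (Real.exp (-1) / 4) ^ ((3 * r + 1 : ℝ) / (2 * (r + 1))) / √(3 / 2)

theorem lowerConst_pos (r : ℕ) : 0 < lowerConst r := by
  unfold lowerConst
  positivity

theorem lowerConst_mul_le {r : ℕ} {t P X : ℝ} (ht : 0 < t) (hP : 0 ≤ P)
    (hPr : (Real.exp (-1) / (4 * t)) ^ (3 * r + 1) ≤ P ^ (2 * (r + 1)))
    (hXt : X ^ 2 ≤ 3 / (2 * t)) :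
    lowerConst r * t ^ (-1 + 2 / ((2 * (r + 1) : ℕ) : ℝ)) * X ≤ P := by
  set γ : ℝ := (3 * r + 1 : ℝ) / (2 * (r + 1)) with hγ
  have hr : (0 : ℝ) < r + 1 := by positivity
  have h1 : (Real.exp (-1) / (4 * t)) ^ γ ≤ P := by
    have h2 : ((Real.exp (-1) / (4 * t)) ^ γ) ^ (2 * (r + 1)) ≤ P ^ (2 * (r + 1)) := by
      refine le_trans (le_of_eq ?_) hPr
      rw [← Real.rpow_mul_natCast (by positivity), ← Real.rpow_natCast]
      congr 1
      rw [hγ]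
      push_cast
      field_simp
    exact le_of_pow_le_pow_left₀ (by omega) hP h2
  have h2 : X ≤ √(3 / 2) * t ^ (-(1 / 2) : ℝ) := by
    refine (Real.le_sqrt_of_sq_le hXt).trans_eq ?_
    rw [show 3 / (2 * t) = 3 / 2 * t⁻¹ by field_simp, Real.sqrt_mul (by norm_num),
      Real.sqrt_eq_rpow t⁻¹, Real.inv_rpow ht.le, Real.rpow_neg ht.le]
  have h3 : (Real.exp (-1) / (4 * t)) ^ γ = (Real.exp (-1) / 4) ^ γ * t ^ (-γ) := by
    rw [Real.rpow_neg ht.le, ← Real.inv_rpow ht.le, ← Real.mul_rpow (by positivity) (by positivity)]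
    congr 1
    field_simp
  have h4 : t ^ (-γ) = t ^ (-1 + 2 / ((2 * (r + 1) : ℕ) : ℝ)) * t ^ (-(1 / 2) : ℝ) := by
    rw [← Real.rpow_add ht]
    congr 1
    rw [hγ]
    push_cast
    field_simp
    ring
  refine le_trans ?_ h1
  rw [h3, h4]
  have hs : 0 < √(3 / 2 : ℝ) := by positivity
  calc lowerConst r * t ^ (-1 + 2 / ((2 * (r + 1) : ℕ) : ℝ)) * X
      ≤ lowerConst r * t ^ (-1 + 2 / ((2 * (r + 1) : ℕ) : ℝ)) *
        (√(3 / 2) * t ^ (-(1 / 2) : ℝ)) := by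
        have := (lowerConst_pos r).le
        gcongr
    _ = _ := by
        rw [lowerConst, ← hγ]
        field_simp

end Estimates

/-! ### The lower bound -/

section LowerBound

variable {A : Type*} [Ring A] [StarRing A] [Algebra ℂ A] [StarModule ℂ A] {φ : FaithfulTrace A}
  {ι : Type*} {a : ι → A}

/-- The lower bound, for `p = 2 (r + 1)` and all non-negative multiples of the resolvent. -/
theorem le_lpNorm_dilation_resolvent {i : ι} (hR : IsRDiagonal φ (a i))
    (hN : HasNonnegCumulants φ (a i)) (ha : a i ≠ 0) (r : ℕ) {t : ℝ} (ht : 0 < t) (ht1 : t < 1)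
    {X : ℝ} (hXt : X ^ 2 ≤ (1 - Real.exp (-2 * t))⁻¹) {ξ : L2 φ}
    (hξ : HasSum (fun n : ℕ => ((Real.exp (-2 * t) ^ n : ℝ) : ℂ) •
      toL2 φ (normalize φ (a i) ^ n)) ξ) {β : ℝ} (hβ : 0 ≤ β) (S : Set A) :
    ENNReal.ofReal (β * (lowerConst r * t ^ (-1 + 2 / ((2 * (r + 1) : ℕ) : ℝ)) * X)) ≤
      lpNorm φ S (2 * (r + 1)) ((β : ℂ) • ξ) := by
  have hM := pairingBound_wordMoment hR hN ha
  have hq := Real.exp_nonneg (-2 * t)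
  have hG := le_geomSum_exp ht
  have hpow := geomSum_pow_le_pNorm_pow hM hq ⌊1 / (4 * t)⌋₊ r
  have hG0 : 0 < Real.exp (-1) / (4 * t) := by positivity
  have hpow' := (pow_le_pow_left₀ hG0.le hG (3 * r + 1)).trans hpow
  have hs : 0 < pNorm φ (2 * (r + 1)) (truncResolvent (Real.exp (-2 * t))
      (2 ^ r * ⌊1 / (4 * t)⌋₊) (normalize φ (a i))) := by
    refine (pNorm_nonneg _ _).lt_of_ne fun h => ?_
    rw [← h, zero_pow (by omega)] at hpow'
    exact absurd hpow' (not_le.mpr (by positivity))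
  refine le_trans (ENNReal.ofReal_le_ofReal (mul_le_mul_of_nonneg_left ?_ hβ))
    (pNorm_truncResolvent_le_lpNorm hM hq (by omega) _ hs hξ hβ S)
  exact lowerConst_mul_le ht hs.le hpow' (hXt.trans (inv_one_sub_exp_le ht ht1))

theorem dilation_lowerBound (hfree : StarFree φ a) (hR : ∀ i, IsRDiagonal φ (a i)) {i : ι}
    (ha : a i ≠ 0) (hN : HasNonnegCumulants φ (a i)) (r : ℕ) {t : ℝ} (ht : 0 < t) (ht1 : t < 1)
    {D : L2hol φ (Set.range a) →L[ℂ] L2hol φ (Set.range a)} (hD : IsDilation φ a t D) (S : Set A) :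
    ENNReal.ofReal (lowerConst r * t ^ (-1 + 2 / ((2 * (r + 1) : ℕ) : ℝ))) ≤
      opNormLp φ S (2 * (r + 1)) D (L2hol φ (Set.range a)) ∧
    ENNReal.ofReal (lowerConst r * t ^ (-1 + 2 / ((2 * (r + 1) : ℕ) : ℝ))) ≤
      opNormLp φ S (2 * (r + 1)) D (L2hol φ {a i}) ∧
    ∃ ψ : L2hol φ (Set.range a),
      HasSum (fun n : ℕ => ((Real.exp (-(n : ℝ) * t) : ℝ) : ℂ) • toL2 φ (normalize φ (a i) ^ n))
        (ψ : L2 φ) ∧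
      (ψ : L2 φ) ∈ L2hol φ {a i} ∧ ψ ≠ 0 ∧
      ENNReal.ofReal (lowerConst r * t ^ (-1 + 2 / ((2 * (r + 1) : ℕ) : ℝ)) * ‖ψ‖) ≤
        lpNorm φ S (2 * (r + 1)) (D ψ : L2 φ) := by
  obtain ⟨ψ, hψ, hψmem, hψ0, hψnorm, hDψ⟩ := exists_resolvent hfree hR i ht
  have hpos : 0 < ‖ψ‖ := norm_pos_iff.mpr hψ0
  have hbound := fun (β : ℝ) (hβ : 0 ≤ β) => le_lpNorm_dilation_resolvent (hR i) hN ha r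
    ht ht1 hψnorm (hDψ D hD) hβ S
  have hop : ∀ F : Submodule ℂ (L2 φ), (ψ : L2 φ) ∈ F →
      ENNReal.ofReal (lowerConst r * t ^ (-1 + 2 / ((2 * (r + 1) : ℕ) : ℝ))) ≤
        opNormLp φ S (2 * (r + 1)) D F := by
    intro F hF
    have h1 := hbound ‖ψ‖⁻¹ (by positivity)
    rw [mul_comm, mul_assoc, mul_inv_cancel₀ hpos.ne', mul_one] at h1
    have hmem : ((((‖ψ‖⁻¹ : ℝ) : ℂ) • ψ : L2hol φ (Set.range a)) : L2 φ) ∈ F :=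
      Submodule.smul_mem F _ hF
    have hle : ‖((‖ψ‖⁻¹ : ℝ) : ℂ) • ψ‖ ≤ 1 := by
      rw [norm_smul, Complex.norm_real, norm_inv, norm_norm, inv_mul_cancel₀ hpos.ne']
    have hDs : ((D (((‖ψ‖⁻¹ : ℝ) : ℂ) • ψ) : L2hol φ (Set.range a)) : L2 φ) =
        ((‖ψ‖⁻¹ : ℝ) : ℂ) • (D ψ : L2 φ) := by
      rw [map_smul, Submodule.coe_smul]
    rw [← hDs] at h1
    exact h1.trans (le_iSup₂_of_le (((‖ψ‖⁻¹ : ℝ) : ℂ) • ψ) hmem (le_iSup_of_le hle le_rfl))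
  refine ⟨hop _ ψ.2, hop _ hψmem, ψ, hψ, hψmem, hψ0, ?_⟩
  have h1 := hbound 1 zero_le_one
  rwa [one_mul, Complex.ofReal_one, one_smul] at h1

end LowerBound

end FreeProb

theorem mainTheorem4 (p : ℕ) (hp : Even p) (hp2 : 2 ≤ p) :
    ∃ α : ℝ, 0 < α ∧
      ∀ (H : Type u) [NormedAddCommGroup H] [InnerProductSpace ℂ H] [CompleteSpace H]
        (M : VonNeumannAlgebra H) (φ : FreeProb.FaithfulTrace M) (_ : FreeProb.IsNormal φ)
        (ι : Type v) (a : ι → M) (i₁ : ι),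
        FreeProb.StarFree φ a →
        (∀ i, FreeProb.IsRDiagonal φ (a i)) →
        a i₁ ≠ 0 →
        FreeProb.HasNonnegCumulants φ (a i₁) →
        ∀ t : ℝ, 0 < t → t < 1 →
          -- the dilation operator exists and is unique
          (∃! D, FreeProb.IsDilation φ a t D) ∧
          ∀ D, FreeProb.IsDilation φ a t D →
            -- the lower bound on the norm from `L²_hol(a)` to `L^p(W*(a), φ)`
            ENNReal.ofReal (α * t ^ (-1 + 2 / (p : ℝ))) ≤
              FreeProb.opNormLp φ (FreeProb.wStar (Set.range a)) p D
                (FreeProb.L2hol φ (Set.range a)) ∧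
            -- the same bound on the subspace `L²_hol(a i₁)`
            ENNReal.ofReal (α * t ^ (-1 + 2 / (p : ℝ))) ≤
              FreeProb.opNormLp φ (FreeProb.wStar (Set.range a)) p D
                (FreeProb.L2hol φ {a i₁}) ∧
            -- witnessed by the resolvent of the normalized generator
            ∃ ψ : FreeProb.L2hol φ (Set.range a),
              HasSum (fun n : ℕ => ((Real.exp (-(n : ℝ) * t) : ℝ) : ℂ) •
                FreeProb.toL2 φ ((((‖FreeProb.toL2 φ (a i₁)‖⁻¹ : ℝ) : ℂ) • a i₁) ^ n))
                (ψ : FreeProb.L2 φ) ∧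
              (ψ : FreeProb.L2 φ) ∈ FreeProb.L2hol φ {a i₁} ∧
              ψ ≠ 0 ∧
              ENNReal.ofReal (α * t ^ (-1 + 2 / (p : ℝ)) * ‖ψ‖) ≤
                FreeProb.lpNorm φ (FreeProb.wStar (Set.range a)) p (D ψ : FreeProb.L2 φ) := by
  obtain ⟨r, rfl⟩ : ∃ r, p = 2 * (r + 1) := by
    obtain ⟨m, rfl⟩ := hp
    exact ⟨m - 1, by omega⟩
  refine ⟨FreeProb.lowerConst r, FreeProb.lowerConst_pos r, ?_⟩
  intro H _ _ _ M φ _ ι a i₁ hfree hR ha hN t ht ht1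
  exact ⟨FreeProb.existsUnique_isDilation hfree hR ht, fun D hD =>
    FreeProb.dilation_lowerBound hfree hR ha hN r ht ht1 hD _⟩
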